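/- For a nonzero matrix $A\in\mathbb{R}^{m\times n}$ let $\|A\|$ be its spectral norm, $\|A\|_F$ its Frobenius norm, and $\rho=\|A\|_F^2/\|A\|^2\ge 1$ its effective rank. For $\alpha\ge 0$ let $\chi^2_{(1,\alpha)}(t)=\mathbb{P}(\xi^2+\alpha\eta^2\le t)$, where $\xi,\eta$ are independent standard normal random variables, let $p_{(1,\alpha)}$ be the corresponding Lebesgue density, and write $\chi_1^2=\chi^2_{(1,0)}$. Let $X_1,X_2$ be independent random vectors in $\mathbb{R}^n$, each with the standard normal distribution $N(0,I_n)$, and, for $\theta\ge 1$, put $$T^{\mathrm{cb}}(\theta,X)=\theta\sqrt{\left(\frac{\|A^\top A X_1\|}{\|A X_1\|}\right)^2+\|A X_2\|^2},\qquad X=(X_1,X_2),$$ where $\|\cdot\|$ of a vector is the Euclidean norm. Then for every $\theta\ge 1$ $$\mathbb{P}\bigl(T^{\mathrm{cb}}(\theta,X)\le\|A\|\bigr)\le g(\theta,\rho),$$ where $$g(\theta,\rho)=\begin{cases}\theta^{-4}/8, & \rho\ge 7,\\[4pt] \displaystyle\int_0^{\theta^{-2}}\chi_1^2\!\left(\frac{(\rho-1)t}{1-t}\right)p_{(1,\rho-1)}\bigl(\theta^{-2}-t\bigr)\,dt,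 & 1+\theta^{-2}\le\rho\le 7,\\[8pt] \displaystyle\int_0^{\theta^{-2}}\chi_1^2\!\left(\frac{(\rho-1)t}{1-t}\right)p_{(1,0)}\!\left(\frac{\theta^{-2}-t}{\rho}\right)dt, & 1\le\rho<1+\theta^{-2}.\end{cases}$$ For $\rho=7$, where the first two cases overlap, the inequality holds with either expression. -/

import Mathlib

open MeasureTheory ProbabilityTheory

namespace Counterbalance

/-- The spectral norm of a real matrix: the operator norm of `x ↦ A x` between Euclidean spaces. -/
noncomputable def opNorm {m n : ℕ} (A : Matrix (Fin m) (Fin n) ℝ) : ℝ :=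
  ‖LinearMap.toContinuousLinearMap (Matrix.toEuclideanLin A)‖

/-- The Frobenius norm of a real matrix. -/
noncomputable def frobNorm {m n : ℕ} (A : Matrix (Fin m) (Fin n) ℝ) : ℝ :=
  Real.sqrt (∑ i, ∑ j, A i j ^ 2)

/-- The effective rank of a (nonzero) real matrix. -/
noncomputable def effectiveRank {m n : ℕ} (A : Matrix (Fin m) (Fin n) ℝ) : ℝ :=
  frobNorm A ^ 2 / opNorm A ^ 2

/-- The Counterbalance statistic, as a function of `θ` and of the two sampled vectors. -/
noncomputable def statistic {m n : ℕ} (A : Matrix (Fin m) (Fin n) ℝ) (θ : ℝ)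
    (x₁ x₂ : EuclideanSpace ℝ (Fin n)) : ℝ :=
  θ * Real.sqrt
    ((‖Matrix.toEuclideanLin (A.transpose * A) x₁‖ / ‖Matrix.toEuclideanLin A x₁‖) ^ 2
      + ‖Matrix.toEuclideanLin A x₂‖ ^ 2)

/-- The law of `ξ² + α η²` for independent standard normal `ξ`, `η`. -/
noncomputable def weightedChiSq (α : ℝ) : Measure ℝ :=
  ((gaussianReal 0 1).prod (gaussianReal 0 1)).map (fun z : ℝ × ℝ => z.1 ^ 2 + α * z.2 ^ 2)

/-- The distribution function `t ↦ P(ξ² + α η² ≤ t)`. -/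
noncomputable def weightedChiSqCdf (α t : ℝ) : ℝ :=
  (weightedChiSq α).real (Set.Iic t)

/-- The Lebesgue density of `ξ² + α η²`. -/
noncomputable def weightedChiSqPdf (α t : ℝ) : ℝ :=
  ((weightedChiSq α).rnDeriv volume t).toReal

/-- The distribution function of the chi-squared law with one degree of freedom. -/
noncomputable def chiSqCdf (t : ℝ) : ℝ :=
  weightedChiSqCdf 0 t

end Counterbalance

/-! ### Chi-squared laws with one and two degrees of freedom. -/

namespace Counterbalance

open Set

/-! Divide the squared singular values by ‖A‖² to get weights μ_i with maximum 1 and sum ρ, and put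
τ = θ⁻². In a basis of right singular vectors the event forces N/D + S ≤ τ, where N = Σ μ_i² x_i², D
= Σ μ_i x_i², S = Σ μ_i y_i² and all x_i, y_i are independent standard normal
(`exists_singular_basis`, `measure_statistic_eq`, `ratio_le_of_statistic_le`).

Fix y and let t = τ − S. Keeping only the top term of N, the inequality N ≤ tD forces x_{i₀}² to be
at most t/(1−t) times the part of D without i₀. The χ²₁ distribution function is concave, so by
Jensen the conditional probability is at most χ²₁((ρ−1)t/(1−t)) (`piNormal_ratio_le`). This is the
distribution function at t of z²/(ρ−1+z²). Hence the probability is at most the mass of (−∞, τ]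
under the law of S convolved with `ratioLaw (ρ - 1)` (`piNormal_prod_le`).

It remains to replace the law of S by one with a larger distribution function up to τ. If ρ < 1+τ,
all but the top term of S are dropped, and the monotone χ²₁ density allows the further division by
ρ. If ρ ≥ 1+τ, the part of S below the top term has mean ρ−1 ≥ τ, and `formLaw_Iic_le_sqLaw`
replaces it by (ρ−1)η². If ρ ≥ 7, the ratio N/D is ignored and a Chernoff bound on S suffices
(`piNormal_sum_le_of_seven_le`).

The heart is `formLaw_merge`: for Q = ax² + by² + r with a the largest coefficient, moving weight
from b to a raises P(Q ≤ t) for t below the mean. The derivative along this move is q_y − q_x, the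
difference of the densities of Q weighted by y² and by x². Weighting by x² amounts to adding a·u to
Q, with u an independent χ²₂ variable, and likewise for y² and b·u. The resolvent identity for
exponential laws then gives a·q_x = b·q_y + (a−b)·(E_a q_y), where E_c is convolution with the
exponential density of mean 2c. So it is enough that E_a q ≤ q for q = q_y. Size biasing of Q yields
the Volterra inequality Σ c·E_c q(t) ≤ t·q(t), summed over all coefficients c. As long as E_a q ≤ q
up to t, one has E_c q ≥ E_a q for c ≤ a, hence (Σ c)·E_a q(t) ≤ t·q(t). A first violation before
the mean Σ c is therefore impossible (`expAvg_le_of_volterra`). -/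

/-- The standard normal law on the line. -/
noncomputable abbrev stdNormal : Measure ℝ := gaussianReal 0 1

/-- The chi-squared law with two degrees of freedom. -/
noncomputable def chiSqTwo : Measure ℝ :=
  (volume.restrict (Ioi 0)).withDensity (fun u => ENNReal.ofReal (Real.exp (-u / 2) / 2))

lemma lintegral_chiSqTwo {F : ℝ → ENNReal} (hF : Measurable F) :
    ∫⁻ u, F u ∂chiSqTwo = ∫⁻ u in Ioi 0, ENNReal.ofReal (Real.exp (-u / 2) / 2) * F u := by
  rw [chiSqTwo, lintegral_withDensity_eq_lintegral_mul _ (by fun_prop) hF]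
  rfl

instance : IsProbabilityMeasure chiSqTwo := by
  constructor
  have h := lintegral_chiSqTwo (F := fun _ => 1) measurable_const
  rw [lintegral_const, one_mul] at h
  rw [h]
  simp only [mul_one]
  rw [← ofReal_integral_eq_lintegral_ofReal]
  · have : ∀ u : ℝ, Real.exp (-u / 2) / 2 = (1 / 2) * Real.exp ((-1 / 2) * u) := by
      intro u; rw [show -u / 2 = (-1 / 2) * u by ring]; ring
    simp_rw [this]
    rw [integral_const_mul, integral_exp_mul_Ioi (by norm_num)]
    norm_num
  · have := (integrableOn_exp_mul_Ioi (a := -1 / 2) (by norm_num) 0).div_const 2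
    refine this.congr (ae_of_all _ fun u => ?_)
    simp only
    rw [show -u / 2 = (-1 / 2) * u by ring]
  · exact ae_of_all _ fun u => by positivity

/-- Change of variables y = t + c u: the shifted and scaled law is exponential of mean 2c started at
t. -/
lemma lintegral_chiSqTwo_affine {c : ℝ} (hc : 0 < c) (t : ℝ) {χ : ℝ → ENNReal}
    (hχ : Measurable χ) :
    ∫⁻ u, χ (t + c * u) ∂chiSqTwo =
      ∫⁻ y in Ioi t, ENNReal.ofReal (Real.exp (-(y - t) / (2 * c)) / (2 * c)) * χ y := by
  rw [lintegral_chiSqTwo (by fun_prop)]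
  have him : (fun u : ℝ => t + c * u) '' Ioi 0 = Ioi t := by
    ext y
    simp only [mem_image, mem_Ioi]
    constructor
    · rintro ⟨u, hu, rfl⟩
      have := mul_pos hc hu
      linarith
    · intro hy
      exact ⟨(y - t) / c, div_pos (by linarith) hc, by field_simp; ring⟩
  rw [← him, lintegral_image_eq_lintegral_abs_deriv_mul (f' := fun _ => c) measurableSet_Ioi]
  · refine setLIntegral_congr_fun measurableSet_Ioi fun u _ => ?_
    rw [← mul_assoc, ← ENNReal.ofReal_mul (abs_nonneg c), abs_of_pos hc]
    congr 2
    rw [show -(t + c * u - t) / (2 * c) = -u / 2 by field_simp; ring]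
    field_simp
  · intro x _
    have h := ((hasDerivAt_id x).const_mul c).const_add t
    simp only [mul_one] at h
    exact h.hasDerivWithinAt
  · intro x _ y _ hxy
    simp only [add_right_inj] at hxy
    exact mul_left_cancel₀ hc.ne' hxy

/-- The Gaussian density is even, so the integral is twice the one over z > 0, where y = z² is a
valid substitution. -/
lemma lintegral_stdNormal_sq {χ : ℝ → ENNReal} (hχ : Measurable χ) :
    ∫⁻ z, χ (z ^ 2) ∂stdNormal =
      ∫⁻ y in Ioi 0, ENNReal.ofReal (Real.exp (-y / 2) / √(2 * Real.pi * y)) * χ y := by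
  set g : ℝ → ENNReal := fun z => gaussianPDF 0 1 z * χ (z ^ 2) with hg
  have hgm : Measurable g := by
    have := measurable_gaussianPDF 0 1
    fun_prop
  have h1 : ∫⁻ z, χ (z ^ 2) ∂stdNormal = ∫⁻ z, g z := by
    rw [stdNormal, gaussianReal_of_var_ne_zero _ one_ne_zero,
      lintegral_withDensity_eq_lintegral_mul _ (measurable_gaussianPDF 0 1) (by fun_prop)]
    rfl
  have heven : ∀ z, g (-z) = g z := by
    intro z; simp [hg, gaussianPDF, gaussianPDFReal]
  have h2 : ∫⁻ z in Iic 0, g z = ∫⁻ z in Ioi 0, g z := by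
    have him : (fun u : ℝ => -u) '' Ioi 0 = Iio 0 := by simp
    rw [setLIntegral_congr (Iio_ae_eq_Iic (a := (0 : ℝ))).symm, ← him,
      lintegral_image_eq_lintegral_abs_deriv_mul (f' := fun _ => -1) measurableSet_Ioi
        (fun x _ => (hasDerivAt_neg x).hasDerivWithinAt) neg_injective.injOn]
    simp [heven]
  have h3 : ∫⁻ z, g z = ∫⁻ z in Ioi 0, 2 * g z := by
    rw [← lintegral_add_compl g measurableSet_Iic (A := Iic (0 : ℝ)), compl_Iic, h2,
      lintegral_const_mul _ hgm, two_mul]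
  have him : (fun u : ℝ => u ^ 2) '' Ioi 0 = Ioi 0 := by
    ext y
    simp only [mem_image, mem_Ioi]
    constructor
    · rintro ⟨u, hu, rfl⟩
      positivity
    · intro hy
      exact ⟨√y, Real.sqrt_pos.2 hy, Real.sq_sqrt hy.le⟩
  rw [h1, h3]
  conv_rhs => rw [← him]
  rw [lintegral_image_eq_lintegral_abs_deriv_mul (f' := fun x => 2 * x) measurableSet_Ioi]
  · refine setLIntegral_congr_fun measurableSet_Ioi fun z hz => ?_
    have hz : 0 < z := hz
    simp only [hg]
    rw [← mul_assoc, ← mul_assoc, ← ENNReal.ofReal_mul (abs_nonneg _), abs_of_pos (by positivity),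
      gaussianPDF, show (2 : ENNReal) = ENNReal.ofReal 2 by simp, ← ENNReal.ofReal_mul (by norm_num)]
    congr 2
    rw [gaussianPDFReal, Real.sqrt_mul (x := 2 * Real.pi) (by positivity) (z ^ 2), Real.sqrt_sq hz.le]
    simp only [NNReal.coe_one, mul_one, sub_zero]
    field_simp
  · intro x _
    have h := hasDerivAt_pow 2 x
    simp only [Nat.cast_ofNat, Nat.add_one_sub_one, pow_one] at h
    exact h.hasDerivWithinAt
  · intro x hx y hy hxy
    exact (pow_left_inj₀ (le_of_lt hx) (le_of_lt hy) two_ne_zero).1 hxy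

/-- The size-biased χ²₁ law is χ²₃, the convolution of χ²₁ and χ²₂. On densities the exponentials
combine, and what remains is the integral of t^(-1/2) over (0, y), equal to 2√y. -/
lemma lintegral_stdNormal_sq_mul {χ : ℝ → ENNReal} (hχ : Measurable χ) :
    ∫⁻ z, ENNReal.ofReal (z ^ 2) * χ (z ^ 2) ∂stdNormal =
      ∫⁻ z, ∫⁻ u, χ (z ^ 2 + u) ∂chiSqTwo ∂stdNormal := by
  have h1 := lintegral_stdNormal_sq (χ := fun y => ENNReal.ofReal y * χ y) (by fun_prop)
  have h2 := lintegral_stdNormal_sq (χ := fun y => ∫⁻ u, χ (y + u) ∂chiSqTwo) (by fun_prop)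
  rw [h1, h2]
  have h3 : ∀ t, ∫⁻ u, χ (t + u) ∂chiSqTwo =
      ∫⁻ y, (Ioi t).indicator (fun _ => 1) y *
        (ENNReal.ofReal (Real.exp (-(y - t) / 2) / 2) * χ y) := by
    intro t
    have := lintegral_chiSqTwo_affine one_pos t hχ
    simp only [one_mul, mul_one] at this
    rw [this, ← lintegral_indicator measurableSet_Ioi]
    congr 1; ext y
    by_cases hy : y ∈ Ioi t <;> simp [hy]
  simp_rw [h3]
  rw [← lintegral_indicator measurableSet_Ioi, ← lintegral_indicator measurableSet_Ioi]
  have h4 : ∀ t, (Ioi (0 : ℝ)).indicator (fun t => ENNReal.ofReal (Real.exp (-t / 2) /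
        √(2 * Real.pi * t)) * ∫⁻ y, (Ioi t).indicator (fun _ => 1) y *
        (ENNReal.ofReal (Real.exp (-(y - t) / 2) / 2) * χ y)) t =
      ∫⁻ y, (Ioo 0 y).indicator (fun t => ENNReal.ofReal (1 / √t)) t *
        (ENNReal.ofReal (Real.exp (-y / 2) / (2 * √(2 * Real.pi))) * χ y) := by
    intro t
    by_cases ht : 0 < t
    · rw [indicator_of_mem (by exact ht), ← lintegral_const_mul']
      swap; · exact ENNReal.ofReal_ne_top
      congr 1; ext y
      by_cases hy : t < y
      · rw [indicator_of_mem (by exact hy), indicator_of_mem (by exact ⟨ht, hy⟩), one_mul,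
          ← mul_assoc, ← mul_assoc, ← ENNReal.ofReal_mul (by positivity),
          ← ENNReal.ofReal_mul (by positivity)]
        congr 2
        rw [Real.sqrt_mul (by positivity), show -y / 2 = -t / 2 + -(y - t) / 2 by ring,
          Real.exp_add]
        field_simp
      · rw [indicator_of_notMem (by exact hy), indicator_of_notMem (by rintro ⟨_, h⟩; exact hy h)]
        simp
    · rw [indicator_of_notMem (by exact ht)]
      symm
      have : (fun y => (Ioo 0 y).indicator (fun t => ENNReal.ofReal (1 / √t)) t *
          (ENNReal.ofReal (Real.exp (-y / 2) / (2 * √(2 * Real.pi))) * χ y)) = fun _ => 0 := by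
        ext y
        rw [indicator_of_notMem (by rintro ⟨h, _⟩; exact ht h)]
        simp
      rw [this, lintegral_zero]
  simp_rw [h4]
  rw [lintegral_lintegral_swap]
  · congr 1; ext y
    rw [lintegral_mul_const]
    · by_cases hy : 0 < y
      · rw [indicator_of_mem (by exact hy), lintegral_indicator measurableSet_Ioo,
          ← mul_assoc, ← mul_assoc]
        congr 1
        have : ∫⁻ t in Ioo 0 y, ENNReal.ofReal (1 / √t) = ENNReal.ofReal (2 * √y) := by
          rw [← ofReal_integral_eq_lintegral_ofReal]
          · congr 1
            rw [← integral_Ioc_eq_integral_Ioo, ← intervalIntegral.integral_of_le hy.le]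
            simp_rw [Real.sqrt_eq_rpow, one_div]
            have : ∀ x ∈ uIcc 0 y, (x ^ (2⁻¹ : ℝ))⁻¹ = x ^ (-2⁻¹ : ℝ) := by
              intro x hx
              rw [uIcc_of_le hy.le] at hx
              rw [Real.rpow_neg hx.1]
            rw [intervalIntegral.integral_congr this, integral_rpow (by left; norm_num)]
            norm_num
            ring
          · have h : IntervalIntegrable (fun x : ℝ => x ^ (-2⁻¹ : ℝ)) volume 0 y :=
              intervalIntegral.intervalIntegrable_rpow' (by norm_num)
            rw [intervalIntegrable_iff_integrableOn_Ioo_of_le hy.le] at h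
            refine h.congr_fun (fun x hx => ?_) measurableSet_Ioo
            simp only
            rw [Real.rpow_neg hx.1.le, Real.sqrt_eq_rpow, one_div, one_div]
          · exact ae_of_all _ fun _ => by positivity
        rw [this, ← ENNReal.ofReal_mul (by positivity), ← ENNReal.ofReal_mul (by positivity)]
        congr 1
        rw [Real.sqrt_mul (by positivity)]
        have : √y ≠ 0 := (Real.sqrt_pos.2 hy).ne'
        field_simp
        rw [Real.sq_sqrt hy.le]
      · rw [indicator_of_notMem (by exact hy), Ioo_eq_empty (by simpa using hy)]
        simp
    · exact Measurable.indicator (by fun_prop) measurableSet_Ioo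
  · have hm : Measurable (fun p : ℝ × ℝ => {p : ℝ × ℝ | 0 < p.1 ∧ p.1 < p.2}.indicator
        (fun p => ENNReal.ofReal (1 / √p.1)) p) := by
      refine Measurable.indicator (by fun_prop) ?_
      exact (measurableSet_lt measurable_const measurable_fst).inter
        (measurableSet_lt measurable_fst measurable_snd)
    refine (hm.mul (?_ : Measurable fun p : ℝ × ℝ => ENNReal.ofReal (Real.exp (-p.2 / 2) /
      (2 * √(2 * Real.pi))) * χ p.2)).aemeasurable
    fun_prop

lemma lintegral_stdNormal_mul_sq {χ : ℝ → ENNReal} (hχ : Measurable χ) (c : ℝ) :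
    ∫⁻ z, ENNReal.ofReal (z ^ 2) * χ (c * z ^ 2) ∂stdNormal =
      ∫⁻ z, ∫⁻ u, χ (c * z ^ 2 + c * u) ∂chiSqTwo ∂stdNormal := by
  have := lintegral_stdNormal_sq_mul (χ := fun y => χ (c * y)) (by fun_prop)
  simpa only [mul_add] using this

end Counterbalance

/-! ### The resolvent identity for exponential laws, and polar coordinates. -/

namespace Counterbalance

open Set

/-- In Laplace transforms this is a/(1+2as) = b/(1+2bs) + (a−b)/((1+2as)(1+2bs)). The proof compares
densities, that of bu + av being (e^(-y/2a) − e^(-y/2b))/(2(a−b)). -/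
lemma lintegral_chiSqTwo_resolvent {a b : ℝ} (hb : 0 < b) (hab : b ≤ a) {χ : ℝ → ENNReal}
    (hχ : Measurable χ) :
    ENNReal.ofReal a * ∫⁻ u, χ (a * u) ∂chiSqTwo =
      ENNReal.ofReal b * ∫⁻ u, χ (b * u) ∂chiSqTwo +
        ENNReal.ofReal (a - b) * ∫⁻ u, ∫⁻ v, χ (b * u + a * v) ∂chiSqTwo ∂chiSqTwo := by
  have ha : 0 < a := hb.trans_le hab
  -- The density of bu + av computed below has a − b in its denominator.
  rcases hab.eq_or_lt with rfl | hab'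
  · simp
  have e1 : ∀ c, 0 < c → ∫⁻ u, χ (c * u) ∂chiSqTwo =
      ∫⁻ y in Ioi 0, ENNReal.ofReal (Real.exp (-y / (2 * c)) / (2 * c)) * χ y := by
    intro c hc
    have := lintegral_chiSqTwo_affine hc 0 hχ
    simpa using this
  have e2 : ∫⁻ u, ∫⁻ v, χ (b * u + a * v) ∂chiSqTwo ∂chiSqTwo =
      ∫⁻ y in Ioi 0, ENNReal.ofReal
        ((Real.exp (-y / (2 * a)) - Real.exp (-y / (2 * b))) / (2 * (a - b))) * χ y := by
    have f1 : ∀ u, ∫⁻ v, χ (b * u + a * v) ∂chiSqTwo =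
        ∫⁻ y, (Ioi (b * u)).indicator (fun _ => 1) y *
          (ENNReal.ofReal (Real.exp (-(y - b * u) / (2 * a)) / (2 * a)) * χ y) := by
      intro u
      rw [lintegral_chiSqTwo_affine ha _ hχ, ← lintegral_indicator measurableSet_Ioi]
      congr 1; ext y
      by_cases hy : y ∈ Ioi (b * u) <;> simp [hy]
    rw [lintegral_chiSqTwo (by fun_prop)]
    simp_rw [f1]
    rw [← lintegral_indicator measurableSet_Ioi, ← lintegral_indicator measurableSet_Ioi]
    have f2 : ∀ u, (Ioi (0 : ℝ)).indicator (fun u => ENNReal.ofReal (Real.exp (-u / 2) / 2) *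
          ∫⁻ y, (Ioi (b * u)).indicator (fun _ => 1) y *
          (ENNReal.ofReal (Real.exp (-(y - b * u) / (2 * a)) / (2 * a)) * χ y)) u =
        ∫⁻ y, (Ioo 0 (y / b)).indicator
          (fun u => ENNReal.ofReal (Real.exp ((b / (2 * a) - 1 / 2) * u))) u *
          (ENNReal.ofReal (Real.exp (-y / (2 * a)) / (4 * a)) * χ y) := by
      intro u
      by_cases hu : 0 < u
      · rw [indicator_of_mem (by exact hu), ← lintegral_const_mul']
        swap; · exact ENNReal.ofReal_ne_top
        congr 1; ext y
        by_cases hy : b * u < y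
        · rw [indicator_of_mem (by exact hy),
            indicator_of_mem (by exact ⟨hu, by rw [lt_div_iff₀ hb]; linarith⟩), one_mul,
            ← mul_assoc, ← mul_assoc, ← ENNReal.ofReal_mul (by positivity),
            ← ENNReal.ofReal_mul (by positivity)]
          congr 2
          rw [div_mul_div_comm, ← Real.exp_add, ← mul_div_assoc, ← Real.exp_add]
          congr 1
          · congr 1; field_simp; ring
          · ring
        · rw [indicator_of_notMem (by exact hy), indicator_of_notMem (by
            rintro ⟨_, h⟩; rw [lt_div_iff₀ hb] at h; exact hy (by linarith))]
          simp
      · rw [indicator_of_notMem (by exact hu)]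
        have : (fun y => (Ioo 0 (y / b)).indicator
            (fun u => ENNReal.ofReal (Real.exp ((b / (2 * a) - 1 / 2) * u))) u *
            (ENNReal.ofReal (Real.exp (-y / (2 * a)) / (4 * a)) * χ y)) = fun _ => 0 := by
          ext y
          rw [indicator_of_notMem (by rintro ⟨h, _⟩; exact hu h)]
          simp
        rw [this, lintegral_zero]
    simp_rw [f2]
    rw [lintegral_lintegral_swap]
    · congr 1; ext y
      rw [lintegral_mul_const]
      · by_cases hy : 0 < y
        · have hyb : 0 < y / b := div_pos hy hb
          rw [indicator_of_mem (by exact hy), lintegral_indicator measurableSet_Ioo, ← mul_assoc]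
          congr 1
          have hk : b / (2 * a) - 1 / 2 ≠ 0 := by
            have : b / (2 * a) - 1 / 2 = (b - a) / (2 * a) := by field_simp
            rw [this]
            exact div_ne_zero (by linarith) (by positivity)
          have : ∫⁻ u in Ioo 0 (y / b), ENNReal.ofReal (Real.exp ((b / (2 * a) - 1 / 2) * u)) =
              ENNReal.ofReal ((Real.exp ((b / (2 * a) - 1 / 2) * (y / b)) - 1) /
                (b / (2 * a) - 1 / 2)) := by
            rw [← ofReal_integral_eq_lintegral_ofReal]
            · congr 1
              rw [← integral_Ioc_eq_integral_Ioo, ← intervalIntegral.integral_of_le hyb.le,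
                intervalIntegral.integral_comp_mul_left _ hk, integral_exp]
              simp [div_eq_inv_mul]
            · refine (Continuous.integrableOn_Icc (by fun_prop)).mono_set Ioo_subset_Icc_self
            · exact ae_of_all _ fun _ => by positivity
          rw [this, ← ENNReal.ofReal_mul']
          swap; · positivity
          congr 1
          have h1 : Real.exp (-y / (2 * b)) = Real.exp ((b / (2 * a) - 1 / 2) * (y / b)) *
              Real.exp (-y / (2 * a)) := by
            rw [← Real.exp_add]; congr 1; field_simp; ring
          rw [h1]
          have h2 : b / (2 * a) - 1 / 2 = (b - a) / (2 * a) := by field_simp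
          generalize Real.exp ((b / (2 * a) - 1 / 2) * (y / b)) = X
          rw [h2, show b - a = -(a - b) by ring]
          field_simp
          ring
        · rw [indicator_of_notMem (by exact hy), Ioo_eq_empty]
          · simp
          · simp only [not_lt]
            exact div_nonpos_of_nonpos_of_nonneg (not_lt.1 hy) hb.le
      · exact Measurable.indicator (by fun_prop) measurableSet_Ioo
    · have hm : Measurable (fun p : ℝ × ℝ => {p : ℝ × ℝ | 0 < p.1 ∧ p.1 < p.2 / b}.indicator
          (fun p => ENNReal.ofReal (Real.exp ((b / (2 * a) - 1 / 2) * p.1))) p) := by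
        refine Measurable.indicator (by fun_prop) ?_
        exact (measurableSet_lt measurable_const measurable_fst).inter
          (measurableSet_lt measurable_fst (measurable_snd.div_const b))
      refine (hm.mul (?_ : Measurable fun p : ℝ × ℝ => ENNReal.ofReal (Real.exp (-p.2 / (2 * a)) /
        (4 * a)) * χ p.2)).aemeasurable
      fun_prop
  rw [e1 a ha, e1 b hb, e2, ← lintegral_const_mul _ (by fun_prop),
    ← lintegral_const_mul _ (by fun_prop), ← lintegral_const_mul _ (by fun_prop),
    ← lintegral_add_left (by fun_prop)]
  refine setLIntegral_congr_fun measurableSet_Ioi fun y hy => ?_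
  have hy : 0 < y := hy
  have hexp : Real.exp (-y / (2 * b)) ≤ Real.exp (-y / (2 * a)) := by
    apply Real.exp_le_exp.2
    rw [neg_div, neg_div, neg_le_neg_iff]
    gcongr
  have hd : 0 < a - b := by linarith
  have hnn : 0 ≤ (Real.exp (-y / (2 * a)) - Real.exp (-y / (2 * b))) / (2 * (a - b)) :=
    div_nonneg (by linarith) (by positivity)
  rw [← mul_assoc, ← mul_assoc, ← mul_assoc, ← add_mul, ← ENNReal.ofReal_mul ha.le,
    ← ENNReal.ofReal_mul hb.le, ← ENNReal.ofReal_mul hd.le,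
    ← ENNReal.ofReal_add (by positivity) (mul_nonneg hd.le hnn)]
  congr 2
  field_simp
  ring

/-- The uniform law on angles. -/
noncomputable def angleLaw : Measure ℝ :=
  ENNReal.ofReal (2 * Real.pi)⁻¹ • volume.restrict (Ioo (-Real.pi) Real.pi)

instance : IsProbabilityMeasure angleLaw := by
  constructor
  rw [angleLaw, Measure.smul_apply, Measure.restrict_apply_univ, Real.volume_Ioo, smul_eq_mul,
    ← ENNReal.ofReal_mul (by positivity), ENNReal.ofReal_eq_one]
  field_simp
  ring

/-- Polar coordinates for the squares of a pair of independent standard normal variables. -/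
lemma lintegral_stdNormal_pair_sq {F : ℝ → ℝ → ENNReal} (hF : Measurable (Function.uncurry F)) :
    ∫⁻ x, ∫⁻ y, F (x ^ 2) (y ^ 2) ∂stdNormal ∂stdNormal =
      ∫⁻ φ, ∫⁻ u, F (u * Real.cos φ ^ 2) (u * Real.sin φ ^ 2) ∂chiSqTwo ∂angleLaw := by
  have hFm : ∀ {α : Type} [MeasurableSpace α] {f g : α → ℝ}, Measurable f → Measurable g →
      Measurable (fun x => F (f x) (g x)) := fun hf hg => hF.comp (hf.prodMk hg)
  have hpdf := measurable_gaussianPDF 0 1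
  have h1 : ∫⁻ x, ∫⁻ y, F (x ^ 2) (y ^ 2) ∂stdNormal ∂stdNormal =
      ∫⁻ p : ℝ × ℝ, ENNReal.ofReal ((2 * Real.pi)⁻¹ * Real.exp (-(p.1 ^ 2 + p.2 ^ 2) / 2)) *
        F (p.1 ^ 2) (p.2 ^ 2) := by
    have hm : Measurable (fun p : ℝ × ℝ => F (p.1 ^ 2) (p.2 ^ 2)) :=
      hFm (by fun_prop) (by fun_prop)
    rw [Measure.volume_eq_prod, lintegral_prod _ (by fun_prop)]
    rw [stdNormal, gaussianReal_of_var_ne_zero _ one_ne_zero,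
      lintegral_withDensity_eq_lintegral_mul _ hpdf]
    · congr 1; ext x
      rw [Pi.mul_apply, lintegral_withDensity_eq_lintegral_mul _ hpdf
        (hFm (by fun_prop) (by fun_prop)), ← lintegral_const_mul' _ _ (by simp [gaussianPDF])]
      congr 1; ext y
      rw [Pi.mul_apply, ← mul_assoc, gaussianPDF, gaussianPDF, ← ENNReal.ofReal_mul (by
        rw [gaussianPDFReal]; positivity)]
      congr 2
      simp only [gaussianPDFReal, NNReal.coe_one, mul_one, sub_zero]
      rw [show -(x ^ 2 + y ^ 2) / 2 = -x ^ 2 / 2 + -y ^ 2 / 2 by ring, Real.exp_add]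
      have : √(2 * Real.pi) * √(2 * Real.pi) = 2 * Real.pi := Real.mul_self_sqrt (by positivity)
      generalize √(2 * Real.pi) = s at this
      rw [← this, mul_inv]
      ring
    · exact Measurable.lintegral_prod_right' (f := fun p : ℝ × ℝ => F (p.1 ^ 2) (p.2 ^ 2)) hm
  rw [h1, ← lintegral_comp_polarCoord_symm]
  have htarget : polarCoord.target = Ioi (0 : ℝ) ×ˢ Ioo (-Real.pi) Real.pi := rfl
  rw [htarget, Measure.volume_eq_prod, ← Measure.prod_restrict, lintegral_prod_symm]
  swap
  · have hm : Measurable (fun p : ℝ × ℝ => F ((p.1 * Real.cos p.2) ^ 2)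
        ((p.1 * Real.sin p.2) ^ 2)) := hFm (by fun_prop) (by fun_prop)
    simp only [polarCoord_symm_apply, smul_eq_mul]
    fun_prop
  rw [angleLaw, lintegral_smul_measure, smul_eq_mul, ← lintegral_const_mul' _ _ (by simp)]
  congr 1; ext φ
  have hm : Measurable (fun u => F (u * Real.cos φ ^ 2) (u * Real.sin φ ^ 2)) :=
    hFm (by fun_prop) (by fun_prop)
  have him : (fun u : ℝ => u ^ 2) '' Ioi 0 = Ioi 0 := by
    ext y
    simp only [mem_image, mem_Ioi]
    constructor
    · rintro ⟨u, hu, rfl⟩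
      positivity
    · intro hy
      exact ⟨√y, Real.sqrt_pos.2 hy, Real.sq_sqrt hy.le⟩
  rw [lintegral_chiSqTwo hm]
  conv_rhs => rw [← him]
  rw [lintegral_image_eq_lintegral_abs_deriv_mul (f' := fun x => 2 * x) measurableSet_Ioi,
    ← lintegral_const_mul' _ _ (by simp)]
  · refine setLIntegral_congr_fun measurableSet_Ioi fun r hr => ?_
    have hr : 0 < r := hr
    simp only [polarCoord_symm_apply, smul_eq_mul]
    rw [← mul_assoc, ← mul_assoc, ← mul_assoc, ← ENNReal.ofReal_mul hr.le, abs_of_pos (by positivity),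
      mul_assoc (ENNReal.ofReal _) (ENNReal.ofReal _) (ENNReal.ofReal _),
      ← ENNReal.ofReal_mul (by positivity), ← ENNReal.ofReal_mul (by positivity), mul_pow, mul_pow]
    congr 2
    rw [show -(r ^ 2 * Real.cos φ ^ 2 + r ^ 2 * Real.sin φ ^ 2) / 2 =
      -(r ^ 2 * (Real.cos φ ^ 2 + Real.sin φ ^ 2)) / 2 by ring, Real.cos_sq_add_sin_sq]
    ring_nf
  · intro x _
    have h := hasDerivAt_pow 2 x
    simp only [Nat.cast_ofNat, Nat.add_one_sub_one, pow_one] at h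
    exact h.hasDerivWithinAt
  · intro x hx y hy hxy
    exact (pow_left_inj₀ (le_of_lt hx) (le_of_lt hy) two_ne_zero).1 hxy

end Counterbalance

/-! ### Gaussian quadratic forms, size biasing and weighted densities. -/

namespace Counterbalance

open Set

/-- The law of `c z²` for a standard normal `z`. -/
noncomputable def sqLaw (c : ℝ) : Measure ℝ := stdNormal.map (fun z => c * z ^ 2)

instance (c : ℝ) : IsProbabilityMeasure (sqLaw c) :=
  Measure.isProbabilityMeasure_map (by fun_prop)

/-- The law of `∑ c zᵢ²`, over the entries `c` of the list, for independent standard normal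
`zᵢ`. -/
noncomputable def formLaw : List ℝ → Measure ℝ
  | [] => Measure.dirac 0
  | c :: l => (sqLaw c).conv (formLaw l)

instance (l : List ℝ) : IsProbabilityMeasure (formLaw l) := by
  induction l with
  | nil => exact inferInstanceAs (IsProbabilityMeasure (Measure.dirac 0))
  | cons c l ih => exact inferInstanceAs (IsProbabilityMeasure ((sqLaw c).conv (formLaw l)))

lemma lintegral_sqLaw (c : ℝ) {ψ : ℝ → ENNReal} (hψ : Measurable ψ) :
    ∫⁻ r, ψ r ∂sqLaw c = ∫⁻ z, ψ (c * z ^ 2) ∂stdNormal := by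
  rw [sqLaw, lintegral_map hψ (by fun_prop)]

lemma lintegral_formLaw_cons (c : ℝ) (l : List ℝ) {ψ : ℝ → ENNReal} (hψ : Measurable ψ) :
    ∫⁻ r, ψ r ∂formLaw (c :: l) = ∫⁻ z, ∫⁻ r, ψ (c * z ^ 2 + r) ∂formLaw l ∂stdNormal := by
  rw [formLaw, Measure.lintegral_conv hψ,
    lintegral_sqLaw c (ψ := fun x => ∫⁻ y, ψ (x + y) ∂formLaw l) (by fun_prop)]

lemma formLaw_nonneg {l : List ℝ} (hl : ∀ c ∈ l, 0 ≤ c) : formLaw l (Iio 0) = 0 := by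
  induction l with
  | nil => simp [formLaw]
  | cons c l ih =>
    have hc : 0 ≤ c := hl c (by simp)
    have hm : Measurable ((Iio (0 : ℝ)).indicator (1 : ℝ → ENNReal)) :=
      measurable_one.indicator measurableSet_Iio
    have : ∀ z : ℝ, ∫⁻ r, (Iio (0 : ℝ)).indicator (1 : ℝ → ENNReal) (c * z ^ 2 + r) ∂formLaw l
        = 0 := by
      intro z
      refine le_antisymm ?_ zero_le
      rw [← ih fun d hd => hl d (by simp [hd]), ← lintegral_indicator_one measurableSet_Iio]
      refine lintegral_mono fun r => ?_
      by_cases hr : r < 0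
      · rw [indicator_of_mem (a := r) (s := Iio (0 : ℝ)) hr]
        exact (indicator_le_self _ _ _).trans le_rfl
      · rw [indicator_of_notMem]
        · exact zero_le
        · simp only [mem_Iio, not_lt] at hr ⊢
          positivity
    rw [← lintegral_indicator_one measurableSet_Iio, lintegral_formLaw_cons _ _ hm]
    simp [this]

lemma ae_formLaw_nonneg {l : List ℝ} (hl : ∀ c ∈ l, 0 ≤ c) : ∀ᵐ r ∂formLaw l, 0 ≤ r := by
  rw [ae_iff]
  simpa [Iio] using formLaw_nonneg hl

/-- Each term is small with positive probability, because a Gaussian charges every neighbourhood of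
0. This feeds the strict positivity of the weighted density, which the first-crossing argument
needs. -/
lemma formLaw_Iio_pos {l : List ℝ} {ε : ℝ} (hε : 0 < ε) : 0 < formLaw l (Iio ε) := by
  induction l generalizing ε with
  | nil => simp [formLaw, hε]
  | cons c l ih =>
    have hm : Measurable ((Iio ε).indicator (1 : ℝ → ENNReal)) :=
      measurable_one.indicator measurableSet_Iio
    rw [← lintegral_indicator_one measurableSet_Iio, lintegral_formLaw_cons _ _ hm]
    have hopen : IsOpen {z : ℝ | c * z ^ 2 < ε / 2} := isOpen_lt (by fun_prop) continuous_const
    have hpos : 0 < stdNormal {z : ℝ | c * z ^ 2 < ε / 2} := by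
      rw [pos_iff_ne_zero]
      intro h
      have h2 := gaussianReal_absolutelyContinuous' 0 (one_ne_zero) h
      refine (hopen.measure_pos volume ⟨0, ?_⟩).ne' h2
      simp [hε]
    refine (ENNReal.mul_pos (ih (half_pos hε)).ne' hpos.ne').trans_le ?_
    rw [← lintegral_indicator_const hopen.measurableSet]
    refine lintegral_mono fun z => ?_
    by_cases hz : c * z ^ 2 < ε / 2
    · rw [indicator_of_mem (by exact hz), ← lintegral_indicator_one measurableSet_Iio]
      refine lintegral_mono fun r => ?_
      by_cases hr : r < ε / 2
      · rw [indicator_of_mem (a := r) (s := Iio (ε / 2)) hr, indicator_of_mem]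
        · rfl
        · simp only [mem_Iio]; linarith
      · rw [indicator_of_notMem (by exact hr)]
        exact zero_le
    · rw [indicator_of_notMem (by exact hz)]
      exact zero_le

lemma lintegral_list_sum {ι α : Type*} [MeasurableSpace α] (μ : Measure α) (l : List ι)
    {f : ι → α → ENNReal} (hf : ∀ i, Measurable (f i)) :
    ∫⁻ x, (l.map fun i => f i x).sum ∂μ = (l.map fun i => ∫⁻ x, f i x ∂μ).sum := by
  induction l with
  | nil => simp
  | cons i l ih => simp [lintegral_add_left (hf i), ih]

/-- Size biasing of a positive Gaussian quadratic form. -/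
lemma lintegral_formLaw_sizeBias {l : List ℝ} (hl : ∀ c ∈ l, 0 ≤ c) {ψ : ℝ → ENNReal}
    (hψ : Measurable ψ) :
    ∫⁻ r, ENNReal.ofReal r * ψ r ∂formLaw l =
      (l.map fun c => ENNReal.ofReal c *
        ∫⁻ r, ∫⁻ u, ψ (r + c * u) ∂chiSqTwo ∂formLaw l).sum := by
  induction l generalizing ψ with
  | nil => simp [formLaw]
  | cons c l ih =>
    have hc : 0 ≤ c := hl c (by simp)
    have hl' : ∀ d ∈ l, 0 ≤ d := fun d hd => hl d (by simp [hd])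
    -- The weight is additive: the head term is size-biased by the one-variable identity, the tail
    -- by induction.
    have e1 : ∀ z : ℝ, ∫⁻ r, ENNReal.ofReal (c * z ^ 2 + r) * ψ (c * z ^ 2 + r) ∂formLaw l =
        ENNReal.ofReal c * (ENNReal.ofReal (z ^ 2) * ∫⁻ r, ψ (c * z ^ 2 + r) ∂formLaw l) +
          (l.map fun d => ENNReal.ofReal d *
            ∫⁻ r, ∫⁻ u, ψ (c * z ^ 2 + (r + d * u)) ∂chiSqTwo ∂formLaw l).sum := by
      intro z
      rw [← ih hl' (ψ := fun r => ψ (c * z ^ 2 + r)) (by fun_prop),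
        ← lintegral_const_mul _ (by fun_prop), ← lintegral_const_mul _ (by fun_prop),
        ← lintegral_add_left (by fun_prop)]
      refine lintegral_congr_ae ?_
      filter_upwards [ae_formLaw_nonneg hl'] with r hr
      rw [ENNReal.ofReal_add (by positivity) hr, ENNReal.ofReal_mul hc]
      ring
    have e2 : ∀ d, ∫⁻ r, ∫⁻ u, ψ (r + d * u) ∂chiSqTwo ∂formLaw (c :: l) =
        ∫⁻ z, ∫⁻ r, ∫⁻ u, ψ (c * z ^ 2 + (r + d * u)) ∂chiSqTwo ∂formLaw l ∂stdNormal := by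
      intro d
      rw [lintegral_formLaw_cons c l (ψ := fun r => ∫⁻ u, ψ (r + d * u) ∂chiSqTwo) (by fun_prop)]
      simp_rw [add_assoc]
    rw [lintegral_formLaw_cons c l (by fun_prop)]
    simp_rw [e1, e2]
    rw [lintegral_add_left (by fun_prop), lintegral_list_sum _ _ (by fun_prop), List.map_cons,
      List.sum_cons, lintegral_const_mul _ (by fun_prop)]
    congr 1
    · congr 1
      rw [lintegral_stdNormal_mul_sq (χ := fun y => ∫⁻ r, ψ (y + r) ∂formLaw l) (by fun_prop)]
      congr 1; ext z
      rw [lintegral_lintegral_swap (by fun_prop)]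
      congr 1; ext r
      congr 1; ext u
      congr 1; ring
    · congr 2; ext d
      rw [lintegral_const_mul _ (by fun_prop)]

/-- The density of the gamma law with shape `2` and mean `4 w`. -/
noncomputable def gammaTwo (w y : ℝ) : ℝ := y / (2 * w ^ 2) * Real.exp (-y / (2 * w))

lemma gammaTwo_nonneg {w y : ℝ} (hy : 0 ≤ y) : 0 ≤ gammaTwo w y := by
  unfold gammaTwo; positivity

lemma gammaTwo_le {w y : ℝ} (hw : 0 < w) : gammaTwo w y ≤ 1 / w := by
  have h := Real.add_one_le_exp (y / (2 * w))
  have h2 : y / (2 * w) * Real.exp (-y / (2 * w)) ≤ 1 := by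
    rw [neg_div, Real.exp_neg]
    rw [mul_inv_le_iff₀ (Real.exp_pos _)]
    linarith
  have : gammaTwo w y = 1 / w * (y / (2 * w) * Real.exp (-y / (2 * w))) := by
    unfold gammaTwo; ring
  rw [this]
  exact mul_le_of_le_one_right (by positivity) h2

/-- The derivative carries the factor 1 − y/(2w), so the mode is at 2w. -/
lemma gammaTwo_monotoneOn {w : ℝ} (hw : 0 < w) : MonotoneOn (gammaTwo w) (Icc 0 (2 * w)) := by
  have hder : ∀ y, HasDerivAt (gammaTwo w)
      (1 / (2 * w ^ 2) * (1 - y / (2 * w)) * Real.exp (-y / (2 * w))) y := by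
    intro y
    have h1 : HasDerivAt (fun y : ℝ => y / (2 * w ^ 2)) (1 / (2 * w ^ 2)) y :=
      (hasDerivAt_id y).div_const _
    have h2 : HasDerivAt (fun y : ℝ => Real.exp (-y / (2 * w)))
        (Real.exp (-y / (2 * w)) * (-1 / (2 * w))) y :=
      (((hasDerivAt_id y).neg).div_const (2 * w)).exp
    have h3 := h1.mul h2
    refine h3.congr_deriv ?_
    ring
  refine monotoneOn_of_deriv_nonneg (convex_Icc _ _)
    (fun y _ => (hder y).continuousAt.continuousWithinAt)
    (fun y _ => (hder y).differentiableAt.differentiableWithinAt) fun y hy => ?_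
  rw [interior_Icc] at hy
  rw [(hder y).deriv]
  have : y / (2 * w) ≤ 1 := by rw [div_le_one (by positivity)]; exact hy.2.le
  have h1 : 0 ≤ 1 - y / (2 * w) := by linarith
  positivity

/-- The value at angle `φ` of the quadratic form with coefficients `a` and `b`. -/
noncomputable def angleForm (a b φ : ℝ) : ℝ := a * Real.cos φ ^ 2 + b * Real.sin φ ^ 2

lemma angleForm_nonneg {a b : ℝ} (ha : 0 ≤ a) (hb : 0 ≤ b) (φ : ℝ) : 0 ≤ angleForm a b φ := by
  unfold angleForm; positivity

lemma le_angleForm {a b m : ℝ} (ha : m ≤ a) (hb : m ≤ b) (φ : ℝ) : m ≤ angleForm a b φ := by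
  unfold angleForm
  have h := Real.cos_sq_add_sin_sq φ
  have h1 := mul_le_mul_of_nonneg_right ha (sq_nonneg (Real.cos φ))
  have h2 := mul_le_mul_of_nonneg_right hb (sq_nonneg (Real.sin φ))
  have h3 : m = m * Real.cos φ ^ 2 + m * Real.sin φ ^ 2 := by rw [← mul_add, h, mul_one]
  linarith

lemma angleForm_le {a b m : ℝ} (ha : a ≤ m) (hb : b ≤ m) (φ : ℝ) : angleForm a b φ ≤ m := by
  unfold angleForm
  have h := Real.cos_sq_add_sin_sq φ
  have h1 := mul_le_mul_of_nonneg_right ha (sq_nonneg (Real.cos φ))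
  have h2 := mul_le_mul_of_nonneg_right hb (sq_nonneg (Real.sin φ))
  have h3 : m = m * Real.cos φ ^ 2 + m * Real.sin φ ^ 2 := by rw [← mul_add, h, mul_one]
  linarith

@[fun_prop]
lemma continuous_angleForm (a b : ℝ) : Continuous (angleForm a b) := by
  unfold angleForm; fun_prop

/-- The density of `Q = a x² + b y² + r` under the measure with weight `α x² + β y²`, for
independent standard normal `x`, `y` and an independent `r` of law `ν`. -/
noncomputable def biasedDensity (α β a b : ℝ) (ν : Measure ℝ) (t : ℝ) : ℝ :=
  ∫ p, angleForm α β p.1 * gammaTwo (angleForm a b p.1) (max (t - p.2) 0) ∂(angleLaw.prod ν)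

section BiasedDensity

variable {α β a b : ℝ} {ν : Measure ℝ}

lemma biasedDensity_integrand_nonneg (hα : 0 ≤ α) (hβ : 0 ≤ β) (t : ℝ) (p : ℝ × ℝ) :
    0 ≤ angleForm α β p.1 * gammaTwo (angleForm a b p.1) (max (t - p.2) 0) :=
  mul_nonneg (angleForm_nonneg hα hβ _) (gammaTwo_nonneg (le_max_right _ _))

lemma norm_biasedDensity_integrand_le (hα : 0 ≤ α) (hβ : 0 ≤ β) (ha : 0 < a) (hb : 0 < b) (t : ℝ)
    (p : ℝ × ℝ) :
    ‖angleForm α β p.1 * gammaTwo (angleForm a b p.1) (max (t - p.2) 0)‖ ≤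
      max α β * (1 / min a b) := by
  have hm : 0 < min a b := lt_min ha hb
  have hw : min a b ≤ angleForm a b p.1 := le_angleForm (min_le_left _ _) (min_le_right _ _) _
  rw [Real.norm_of_nonneg (biasedDensity_integrand_nonneg hα hβ t p)]
  refine mul_le_mul (angleForm_le (le_max_left _ _) (le_max_right _ _) _)
    ((gammaTwo_le (hm.trans_le hw)).trans ?_) (gammaTwo_nonneg (le_max_right _ _))
    (hα.trans (le_max_left _ _))
  exact one_div_le_one_div_of_le hm hw

lemma measurable_biasedDensity_integrand (α β a b : ℝ) :
    Measurable fun q : ℝ × ℝ × ℝ =>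
      angleForm α β q.2.1 * gammaTwo (angleForm a b q.2.1) (max (q.1 - q.2.2) 0) := by
  unfold angleForm gammaTwo
  fun_prop

lemma biasedDensity_nonneg (hα : 0 ≤ α) (hβ : 0 ≤ β) (t : ℝ) :
    0 ≤ biasedDensity α β a b ν t :=
  integral_nonneg fun p => biasedDensity_integrand_nonneg hα hβ t p

lemma biasedDensity_of_nonpos (hν : ν (Iio 0) = 0) {t : ℝ} (ht : t ≤ 0) :
    biasedDensity α β a b ν t = 0 := by
  refine integral_eq_zero_of_ae ?_
  have h : ∀ᵐ p ∂(angleLaw.prod ν), 0 ≤ p.2 := by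
    have : ∀ᵐ r ∂ν, 0 ≤ r := by
      rw [ae_iff]; simpa [Iio] using hν
    exact Measure.quasiMeasurePreserving_snd.ae this
  filter_upwards [h] with p hp
  rw [max_eq_right (by linarith)]
  simp [gammaTwo]

variable [IsProbabilityMeasure ν]

lemma integrable_biasedDensity_integrand (hα : 0 ≤ α) (hβ : 0 ≤ β) (ha : 0 < a) (hb : 0 < b)
    (t : ℝ) :
    Integrable (fun p : ℝ × ℝ =>
      angleForm α β p.1 * gammaTwo (angleForm a b p.1) (max (t - p.2) 0)) (angleLaw.prod ν) :=
  Integrable.of_bound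
    ((measurable_biasedDensity_integrand α β a b).comp measurable_prodMk_left).aestronglyMeasurable
    _ (ae_of_all _ (norm_biasedDensity_integrand_le hα hβ ha hb t))

lemma continuous_biasedDensity (hα : 0 ≤ α) (hβ : 0 ≤ β) (ha : 0 < a) (hb : 0 < b) :
    Continuous (biasedDensity α β a b ν) := by
  refine continuous_of_dominated (bound := fun _ => max α β * (1 / min a b)) (fun t =>
    ((measurable_biasedDensity_integrand α β a b).comp
      measurable_prodMk_left).aestronglyMeasurable)
    (fun t => ae_of_all _ (norm_biasedDensity_integrand_le hα hβ ha hb t)) (integrable_const _)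
    (ae_of_all _ fun p => ?_)
  unfold gammaTwo
  fun_prop

/-- For every angle the integrand increases up to 2w with w ≥ b, so the average increases on [0,
2b]. This starts the comparison with exponential averages near 0. -/
lemma monotoneOn_biasedDensity (hα : 0 ≤ α) (hβ : 0 ≤ β) (hb : 0 < b) (hab : b ≤ a)
    (hν : ν (Iio 0) = 0) : MonotoneOn (biasedDensity α β a b ν) (Icc 0 (2 * b)) := by
  intro s hs t ht hst
  have ha := hb.trans_le hab
  refine integral_mono_ae (integrable_biasedDensity_integrand hα hβ ha hb s)
    (integrable_biasedDensity_integrand hα hβ ha hb t) ?_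
  have h : ∀ᵐ p ∂(angleLaw.prod ν), 0 ≤ p.2 := by
    have : ∀ᵐ r ∂ν, 0 ≤ r := by
      rw [ae_iff]; simpa [Iio] using hν
    exact Measure.quasiMeasurePreserving_snd.ae this
  filter_upwards [h] with p hp
  have hw : b ≤ angleForm a b p.1 := le_angleForm hab le_rfl _
  refine mul_le_mul_of_nonneg_left ?_ (angleForm_nonneg hα hβ _)
  refine gammaTwo_monotoneOn (hb.trans_le hw) ⟨le_max_right _ _, ?_⟩ ⟨le_max_right _ _, ?_⟩ ?_
  · exact max_le (by linarith [hs.2]) (by linarith)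
  · exact max_le (by linarith [ht.2]) (by linarith)
  · exact max_le_max (by linarith) le_rfl

lemma biasedDensity_pos (ha : 0 < a) (hb : 0 < b) (hν : ∀ ε > 0, 0 < ν (Iio ε)) {t : ℝ}
    (ht : 0 < t) : 0 < biasedDensity 0 1 a b ν t := by
  rw [biasedDensity, integral_pos_iff_support_of_nonneg
    (fun p => biasedDensity_integrand_nonneg le_rfl zero_le_one t p)
    (integrable_biasedDensity_integrand le_rfl zero_le_one ha hb t)]
  have hsub : Ioo 0 Real.pi ×ˢ Iio t ⊆ Function.support fun p : ℝ × ℝ =>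
      angleForm 0 1 p.1 * gammaTwo (angleForm a b p.1) (max (t - p.2) 0) := by
    rintro ⟨φ, r⟩ ⟨hφ, hr⟩
    have hr : r < t := hr
    have hs : 0 < Real.sin φ := Real.sin_pos_of_pos_of_lt_pi hφ.1 hφ.2
    have hw : 0 < angleForm a b φ :=
      (lt_min ha hb).trans_le (le_angleForm (min_le_left _ _) (min_le_right _ _) _)
    have h2 : 0 < t - r := by linarith
    refine ne_of_gt (mul_pos ?_ ?_)
    · simp only [angleForm]; positivity
    · simp only [gammaTwo, max_eq_left h2.le]; positivity
  refine lt_of_lt_of_le ?_ (measure_mono hsub)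
  rw [Measure.prod_prod]
  refine ENNReal.mul_pos ?_ (hν t ht).ne'
  rw [angleLaw, Measure.smul_apply, Measure.restrict_apply measurableSet_Ioo,
    inter_eq_left.2 (Ioo_subset_Ioo (by linarith [Real.pi_pos]) le_rfl), Real.volume_Ioo,
    smul_eq_mul, ← ENNReal.ofReal_mul (by positivity)]
  have := Real.pi_pos
  simp only [ne_eq, ENNReal.ofReal_eq_zero, not_le]
  rw [sub_zero]
  positivity

/-- In polar coordinates, at a fixed angle, Q = w u + r with u of law χ²₂, and the weight is u times
a function of the angle. Substituting t = w u + r turns u = (t − r)/w times the exponential density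
into `gammaTwo`. -/
lemma lintegral_biasedDensity (hα : 0 ≤ α) (hβ : 0 ≤ β) (ha : 0 < a) (hb : 0 < b)
    {ψ : ℝ → ENNReal} (hψ : Measurable ψ) :
    ∫⁻ t, ENNReal.ofReal (biasedDensity α β a b ν t) * ψ t =
      ∫⁻ r, ∫⁻ x, ∫⁻ y, ENNReal.ofReal (α * x ^ 2 + β * y ^ 2) * ψ (a * x ^ 2 + b * y ^ 2 + r)
        ∂stdNormal ∂stdNormal ∂ν := by
  have h1 : ∀ r φ, ∫⁻ u, ENNReal.ofReal (α * (u * Real.cos φ ^ 2) + β * (u * Real.sin φ ^ 2)) *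
        ψ (a * (u * Real.cos φ ^ 2) + b * (u * Real.sin φ ^ 2) + r) ∂chiSqTwo =
      ∫⁻ t, ENNReal.ofReal (angleForm α β φ * gammaTwo (angleForm a b φ) (max (t - r) 0)) *
        ψ t := by
    intro r φ
    have hw : 0 < angleForm a b φ :=
      (lt_min ha hb).trans_le (le_angleForm (min_le_left _ _) (min_le_right _ _) _)
    have := lintegral_chiSqTwo_affine hw r (χ := fun y => ENNReal.ofReal
      (angleForm α β φ * ((y - r) / angleForm a b φ)) * ψ y) (by fun_prop)
    have h2 : ∀ u, ENNReal.ofReal (α * (u * Real.cos φ ^ 2) + β * (u * Real.sin φ ^ 2)) *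
        ψ (a * (u * Real.cos φ ^ 2) + b * (u * Real.sin φ ^ 2) + r) =
        ENNReal.ofReal (angleForm α β φ * ((r + angleForm a b φ * u - r) / angleForm a b φ)) *
          ψ (r + angleForm a b φ * u) := by
      intro u
      congr 2
      · rw [add_sub_cancel_left, mul_div_cancel_left₀ _ hw.ne', angleForm]; ring
      · rw [angleForm]; ring
    simp_rw [h2]
    rw [this, ← lintegral_indicator measurableSet_Ioi]
    congr 1; ext t
    by_cases ht : r < t
    · rw [indicator_of_mem (by exact ht), ← mul_assoc, ← ENNReal.ofReal_mul (by positivity)]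
      congr 2
      rw [max_eq_left (by linarith), gammaTwo]
      field_simp
    · rw [indicator_of_notMem (by exact ht), max_eq_right (by linarith), gammaTwo]
      simp
  have h2 : ∀ r, ∫⁻ x, ∫⁻ y, ENNReal.ofReal (α * x ^ 2 + β * y ^ 2) *
        ψ (a * x ^ 2 + b * y ^ 2 + r) ∂stdNormal ∂stdNormal =
      ∫⁻ φ, (∫⁻ t, ENNReal.ofReal
        (angleForm α β φ * gammaTwo (angleForm a b φ) (max (t - r) 0)) * ψ t) ∂angleLaw := by
    intro r
    rw [lintegral_stdNormal_pair_sq (F := fun s t => ENNReal.ofReal (α * s + β * t) *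
      ψ (a * s + b * t + r))]
    · simp_rw [h1]
    · simp only [Function.uncurry_def]; fun_prop
  have hm := measurable_biasedDensity_integrand α β a b
  have hm2 : Measurable fun q : (ℝ × ℝ) × ℝ => ENNReal.ofReal (angleForm α β q.1.2 *
      gammaTwo (angleForm a b q.1.2) (max (q.2 - q.1.1) 0)) * ψ q.2 :=
    (hm.comp (by fun_prop : Measurable fun q : (ℝ × ℝ) × ℝ =>
      (q.2, q.1.2, q.1.1))).ennreal_ofReal.mul (hψ.comp measurable_snd)
  simp_rw [h2]
  rw [← lintegral_prod (μ := ν) (ν := angleLaw) (fun p : ℝ × ℝ => ∫⁻ t,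
    ENNReal.ofReal (angleForm α β p.2 * gammaTwo (angleForm a b p.2) (max (t - p.1) 0)) * ψ t)
    hm2.lintegral_prod_right'.aemeasurable, lintegral_lintegral_swap hm2.aemeasurable]
  congr 1; ext t
  rw [lintegral_mul_const _ ?_, biasedDensity, ofReal_integral_eq_lintegral_ofReal
    (integrable_biasedDensity_integrand hα hβ ha hb t)
    (ae_of_all _ (biasedDensity_integrand_nonneg hα hβ t)), ← lintegral_prod_swap]
  · rfl
  · exact (hm.comp (by fun_prop : Measurable fun q : ℝ × ℝ => (t, q.2, q.1))).ennreal_ofReal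

end BiasedDensity

end Counterbalance

/-! ### Exponential averages and the Volterra comparison. -/

namespace Counterbalance

open Set

/-- The convolution on the half-line of `q` with the exponential density of mean `2 c`. -/
noncomputable def expAvg (c : ℝ) (q : ℝ → ℝ) (x : ℝ) : ℝ :=
  Real.exp (-x / (2 * c)) / (2 * c) * ∫ t in (0 : ℝ)..x, q t * Real.exp (t / (2 * c))

section ExpAvg

variable {q : ℝ → ℝ} {a c x : ℝ}

/-- The average solves the relaxation equation 2c y' = q − y with y(0) = 0; the comparison of
different means rests on it. -/
lemma hasDerivAt_expAvg (hq : Continuous q) (c x : ℝ) :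
    HasDerivAt (expAvg c q) ((q x - expAvg c q x) / (2 * c)) x := by
  have h1 : HasDerivAt (fun x : ℝ => Real.exp (-x / (2 * c)) / (2 * c))
      (Real.exp (-x / (2 * c)) * (-1 / (2 * c)) / (2 * c)) x :=
    ((((hasDerivAt_id x).neg).div_const (2 * c)).exp).div_const _
  have hc : Continuous fun t => q t * Real.exp (t / (2 * c)) := by fun_prop
  have h2 := intervalIntegral.integral_hasDerivAt_right (hc.intervalIntegrable 0 x)
    hc.aestronglyMeasurable.stronglyMeasurableAtFilter hc.continuousAt
  refine (h1.mul h2).congr_deriv ?_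
  have h3 : Real.exp (-x / (2 * c)) * Real.exp (x / (2 * c)) = 1 := by
    rw [← Real.exp_add, neg_div, neg_add_cancel, Real.exp_zero]
  have h4 : Real.exp (-x / (2 * c)) / (2 * c) * (q x * Real.exp (x / (2 * c))) =
      q x / (2 * c) := by
    rw [show Real.exp (-x / (2 * c)) / (2 * c) * (q x * Real.exp (x / (2 * c))) =
      q x / (2 * c) * (Real.exp (-x / (2 * c)) * Real.exp (x / (2 * c))) by ring, h3, mul_one]
  rw [h4, expAvg]
  ring

lemma continuous_expAvg (hq : Continuous q) (c : ℝ) : Continuous (expAvg c q) :=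
  continuous_iff_continuousAt.2 fun x => (hasDerivAt_expAvg hq c x).continuousAt

@[simp] lemma expAvg_zero_right : expAvg c q 0 = 0 := by simp [expAvg]

lemma expAvg_nonneg (hc : 0 ≤ c) (hq0 : ∀ t, 0 ≤ q t) (hx : 0 ≤ x) : 0 ≤ expAvg c q x :=
  mul_nonneg (by positivity) (intervalIntegral.integral_nonneg hx fun t _ =>
    mul_nonneg (hq0 t) (Real.exp_pos _).le)

lemma expAvg_pos (hc : 0 < c) (hq : Continuous q) (hq0 : ∀ t, 0 < t → 0 < q t) (hx : 0 < x) :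
    0 < expAvg c q x :=
  mul_pos (by positivity) (intervalIntegral.intervalIntegral_pos_of_pos_on
    (Continuous.intervalIntegrable (by fun_prop) _ _)
    (fun t ht => mul_pos (hq0 t ht.1) (Real.exp_pos _)) hx)

/-- The exponential kernel has mass at most 1 on [0, x], and q is at most q x there. -/
lemma expAvg_le_of_monotoneOn {ε : ℝ} (hc : 0 < c) (hq : Continuous q) (hq0 : ∀ t, 0 ≤ q t)
    (hmono : MonotoneOn q (Icc 0 ε)) (hx : x ∈ Icc 0 ε) : expAvg c q x ≤ q x := by
  have h1 : ∫ t in (0 : ℝ)..x, q t * Real.exp (t / (2 * c)) ≤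
      ∫ t in (0 : ℝ)..x, q x * Real.exp (t / (2 * c)) := by
    refine intervalIntegral.integral_mono_on hx.1
      (Continuous.intervalIntegrable (by fun_prop) _ _)
      (Continuous.intervalIntegrable (by fun_prop) _ _) fun t ht => ?_
    exact mul_le_mul_of_nonneg_right (hmono ⟨ht.1, ht.2.trans hx.2⟩ hx ht.2) (Real.exp_pos _).le
  have h2 : ∫ t in (0 : ℝ)..x, Real.exp (t / (2 * c)) = 2 * c * (Real.exp (x / (2 * c)) - 1) := by
    rw [intervalIntegral.integral_comp_div (fun t => Real.exp t) (by positivity), integral_exp]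
    simp
  rw [intervalIntegral.integral_const_mul, h2] at h1
  have h3 : Real.exp (-x / (2 * c)) * Real.exp (x / (2 * c)) = 1 := by
    rw [← Real.exp_add, neg_div, neg_add_cancel, Real.exp_zero]
  calc expAvg c q x ≤ Real.exp (-x / (2 * c)) / (2 * c) *
        (q x * (2 * c * (Real.exp (x / (2 * c)) - 1))) :=
        mul_le_mul_of_nonneg_left h1 (by positivity)
    _ = q x * (Real.exp (-x / (2 * c)) * Real.exp (x / (2 * c)) - Real.exp (-x / (2 * c))) := by
        field_simp
    _ ≤ q x * 1 := by
        refine mul_le_mul_of_nonneg_left ?_ (hq0 x)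
        rw [h3]
        linarith [Real.exp_pos (-x / (2 * c))]
    _ = q x := mul_one _

/-- By the two relaxation equations, e^(t/2c)(E_c q − E_a q) has derivative e^(t/2c)(1/(2c) −
1/(2a))(q − E_a q) ≥ 0, and it vanishes at 0. -/
lemma expAvg_anti (hq : Continuous q) (hc : 0 < c) (hca : c ≤ a) (hx : 0 ≤ x)
    (h : ∀ t ∈ Icc 0 x, expAvg a q t ≤ q t) : expAvg a q x ≤ expAvg c q x := by
  have hder : ∀ t, HasDerivAt (fun t => Real.exp (t / (2 * c)) * (expAvg c q t - expAvg a q t))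
      (Real.exp (t / (2 * c)) * ((1 / (2 * c) - 1 / (2 * a)) * (q t - expAvg a q t))) t := by
    intro t
    have h1 : HasDerivAt (fun t : ℝ => Real.exp (t / (2 * c)))
        (Real.exp (t / (2 * c)) * (1 / (2 * c))) t := ((hasDerivAt_id t).div_const (2 * c)).exp
    refine (h1.mul ((hasDerivAt_expAvg hq c t).sub (hasDerivAt_expAvg hq a t))).congr_deriv ?_
    simp only [Pi.sub_apply]
    ring
  have hmono : MonotoneOn (fun t => Real.exp (t / (2 * c)) * (expAvg c q t - expAvg a q t))
      (Icc 0 x) := by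
    refine monotoneOn_of_deriv_nonneg (convex_Icc _ _)
      (fun y _ => (hder y).continuousAt.continuousWithinAt)
      (fun y _ => (hder y).differentiableAt.differentiableWithinAt) fun y hy => ?_
    rw [(hder y).deriv]
    refine mul_nonneg (Real.exp_pos _).le (mul_nonneg ?_ ?_)
    · rw [sub_nonneg]
      exact one_div_le_one_div_of_le (by positivity) (by linarith)
    · linarith [h y (interior_subset hy)]
  have := hmono (left_mem_Icc.2 hx) (right_mem_Icc.2 hx) hx
  simp only [expAvg_zero_right, sub_self, mul_zero] at this
  have := nonneg_of_mul_nonneg_right this (Real.exp_pos _)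
  linarith

/-- A function satisfying a Volterra inequality driven by its exponential averages stays above the
average with the largest mean on `[0, ∑ c]`. -/
lemma expAvg_le_of_volterra {l : List ℝ} {ε : ℝ} (hq : Continuous q) (hq0 : ∀ t, 0 ≤ q t)
    (hqpos : ∀ t, 0 < t → 0 < q t) (ha : 0 < a) (hl : ∀ c ∈ l, 0 ≤ c ∧ c ≤ a)
    (hε : 0 < ε) (hmono : MonotoneOn q (Icc 0 ε))
    (hvol : ∀ t, 0 < t → (l.map fun c => c * expAvg c q t).sum ≤ t * q t)
    (hx : x ∈ Icc 0 l.sum) : expAvg a q x ≤ q x := by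
  -- While the claim holds up to t, every average in the Volterra sum may be replaced by the smaller
  -- one with mean 2a.
  have key : ∀ t, 0 < t → (∀ s ∈ Icc 0 t, expAvg a q s ≤ q s) →
      l.sum * expAvg a q t ≤ t * q t := by
    intro t ht h
    refine le_trans ?_ (hvol t ht)
    have : ∀ l' : List ℝ, (∀ c ∈ l', 0 ≤ c ∧ c ≤ a) →
        l'.sum * expAvg a q t ≤ (l'.map fun c => c * expAvg c q t).sum := by
      intro l' hl'
      induction l' with
      | nil => simp
      | cons c l' ih =>
        rw [List.sum_cons, List.map_cons, List.sum_cons, add_mul]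
        refine add_le_add ?_ (ih fun d hd => hl' d (by simp [hd]))
        obtain ⟨h0, h1⟩ := hl' c (by simp)
        rcases h0.eq_or_lt with rfl | h0
        · simp
        · exact mul_le_mul_of_nonneg_left (expAvg_anti hq h0 h1 ht.le h) h0.le
    exact this l hl
  have hmain : ∀ t, t ∈ Ico 0 l.sum → expAvg a q t ≤ q t := by
    by_contra! hcon
    set B : Set ℝ := {t | t ∈ Ico 0 l.sum ∧ q t < expAvg a q t} with hB
    have hBne : B.Nonempty := hcon
    have hBbd : BddBelow B := ⟨0, fun t ht => ht.1.1⟩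
    -- First-crossing argument: the claim holds on [0, s], and s ≥ ε > 0 by monotonicity of q near
    -- 0.
    set s := sInf B with hs
    have hbelow : ∀ t, 0 ≤ t → t < s → expAvg a q t ≤ q t := by
      intro t ht hts
      by_contra! h
      obtain ⟨t₀, ht₀⟩ := hBne
      have htB : t ∈ B := ⟨⟨ht, (hts.trans_le (csInf_le hBbd ht₀)).trans ht₀.1.2⟩, h⟩
      exact absurd (csInf_le hBbd htB) (not_le.2 hts)
    have hεs : ε ≤ s := by
      refine le_csInf hBne fun t ht => ?_
      by_contra! h
      exact absurd (expAvg_le_of_monotoneOn ha hq hq0 hmono ⟨ht.1.1, h.le⟩) (not_le.2 ht.2)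
    have hs0 : 0 < s := hε.trans_le hεs
    have hsl : s < l.sum := by
      obtain ⟨t₀, ht₀⟩ := hBne
      exact (csInf_le hBbd ht₀).trans_lt ht₀.1.2
    have hcont : Continuous fun t => q t - expAvg a q t := hq.sub (continuous_expAvg hq a)
    have hle : ∀ t ∈ Icc 0 s, expAvg a q t ≤ q t := by
      have hcl : Icc 0 s ⊆ {t | 0 ≤ q t - expAvg a q t} := by
        rw [← closure_Ico hs0.ne]
        refine (isClosed_le continuous_const hcont).closure_subset_iff.2 fun t ht => ?_
        exact sub_nonneg.2 (hbelow t ht.1 ht.2)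
      exact fun t ht => sub_nonneg.1 (hcl ht)
    -- Since s is strictly below the sum, s·E_a q(s) < (Σ c)·E_a q(s) ≤ s·q(s). The strict
    -- inequality persists to the right of s, contradicting the choice of s.
    have hlt : 0 < q s - expAvg a q s := by
      have h1 := key s hs0 hle
      have h2 := expAvg_pos ha hq hqpos hs0
      have h3 : s * expAvg a q s < l.sum * expAvg a q s := mul_lt_mul_of_pos_right hsl h2
      exact sub_pos.2 (lt_of_mul_lt_mul_left (h3.trans_le h1) hs0.le)
    have hnhds : ∀ᶠ t in nhds s, 0 < q t - expAvg a q t :=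
      hcont.continuousAt.eventually (lt_mem_nhds hlt)
    obtain ⟨δ, hδ, hball⟩ := Metric.eventually_nhds_iff.1 hnhds
    obtain ⟨t, htB, htlt⟩ := exists_lt_of_csInf_lt hBne (show sInf B < s + δ by linarith)
    have hst : s ≤ t := csInf_le hBbd htB
    have := hball (y := t) (by rw [Real.dist_eq, abs_of_nonneg (by linarith)]; linarith)
    linarith [htB.2]
  -- At the endpoint x = Σ c the strictness is lost, and the inequality follows by continuity.
  rcases hx.2.lt_or_eq with h | h
  · exact hmain x ⟨hx.1, h⟩
  · rcases hx.1.eq_or_lt with h0 | h0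
    · rw [← h0]; simpa using hq0 0
    have hcl : Icc 0 x ⊆ {t | 0 ≤ q t - expAvg a q t} := by
      rw [← closure_Ico h0.ne]
      refine (isClosed_le continuous_const
        (hq.sub (continuous_expAvg hq a))).closure_subset_iff.2 fun t ht => ?_
      exact sub_nonneg.2 (hmain t ⟨ht.1, h ▸ ht.2⟩)
    exact sub_nonneg.1 (hcl ⟨hx.1, le_rfl⟩)

/-- Tonelli: averaging a density amounts to adding an independent c·u with u of law χ²₂. -/
lemma lintegral_expAvg (hq : Continuous q) (hq0 : ∀ t, 0 ≤ q t) (hqneg : ∀ t ≤ 0, q t = 0)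
    (hc : 0 < c) {ψ : ℝ → ENNReal} (hψ : Measurable ψ) :
    ∫⁻ x, ENNReal.ofReal (expAvg c q x) * ψ x =
      ∫⁻ t, ENNReal.ofReal (q t) * ∫⁻ u, ψ (t + c * u) ∂chiSqTwo := by
  have f1 : ∀ t, ENNReal.ofReal (q t) * ∫⁻ u, ψ (t + c * u) ∂chiSqTwo =
      ∫⁻ y, {p : ℝ × ℝ | p.1 < p.2}.indicator (fun p =>
        ENNReal.ofReal (q p.1 * (Real.exp (-(p.2 - p.1) / (2 * c)) / (2 * c)))) (t, y) * ψ y := by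
    intro t
    rw [lintegral_chiSqTwo_affine hc _ hψ, ← lintegral_const_mul _ (by fun_prop),
      ← lintegral_indicator measurableSet_Ioi]
    congr 1; ext y
    by_cases hy : t < y
    · rw [indicator_of_mem (by exact hy), indicator_of_mem (by exact hy), ← mul_assoc,
        ← ENNReal.ofReal_mul (hq0 t)]
    · rw [indicator_of_notMem (by exact hy), indicator_of_notMem (by exact hy), zero_mul]
  have hm : Measurable ({p : ℝ × ℝ | p.1 < p.2}.indicator fun p =>
      ENNReal.ofReal (q p.1 * (Real.exp (-(p.2 - p.1) / (2 * c)) / (2 * c)))) :=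
    Measurable.indicator (by have := hq.measurable; fun_prop)
      (measurableSet_lt measurable_fst measurable_snd)
  simp_rw [f1]
  rw [lintegral_lintegral_swap (hm.mul (hψ.comp measurable_snd)).aemeasurable]
  congr 1; ext x
  have hmx := hm.comp (measurable_prodMk_right (y := x))
  rw [Function.comp_def] at hmx
  rw [lintegral_mul_const _ hmx]
  congr 1
  have f2 : ∀ t, {p : ℝ × ℝ | p.1 < p.2}.indicator (fun p =>
        ENNReal.ofReal (q p.1 * (Real.exp (-(p.2 - p.1) / (2 * c)) / (2 * c)))) (t, x) =
      (Ioo 0 x).indicator (fun t => ENNReal.ofReal (Real.exp (-x / (2 * c)) / (2 * c) *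
        (q t * Real.exp (t / (2 * c))))) t := by
    intro t
    by_cases ht : t < x
    · rw [indicator_of_mem (by exact ht)]
      by_cases ht0 : 0 < t
      · rw [indicator_of_mem (by exact ⟨ht0, ht⟩)]
        congr 1
        rw [show -(x - t) / (2 * c) = -x / (2 * c) + t / (2 * c) by ring, Real.exp_add]
        ring
      · rw [indicator_of_notMem (fun h => ht0 h.1), hqneg t (not_lt.1 ht0)]
        simp
    · rw [indicator_of_notMem (by exact ht), indicator_of_notMem (fun h => ht h.2)]
  simp_rw [f2]
  rw [lintegral_indicator measurableSet_Ioo]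
  rcases le_or_gt x 0 with hx | hx
  · rw [Ioo_eq_empty (by simpa using hx)]
    have : ∫ t in (0 : ℝ)..x, q t * Real.exp (t / (2 * c)) = 0 := by
      refine intervalIntegral.integral_zero_ae (ae_of_all _ fun t ht => ?_)
      rw [uIoc_of_ge hx] at ht
      rw [hqneg t ht.2, zero_mul]
    simp [expAvg, this]
  · have hcont : Continuous fun t => Real.exp (-x / (2 * c)) / (2 * c) *
        (q t * Real.exp (t / (2 * c))) := by fun_prop
    rw [← ofReal_integral_eq_lintegral_ofReal (hcont.integrableOn_Icc.mono_set Ioo_subset_Icc_self)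
      (ae_of_all _ fun t => mul_nonneg (by positivity) (mul_nonneg (hq0 t) (Real.exp_pos _).le)),
      ← integral_Ioc_eq_integral_Ioo, ← intervalIntegral.integral_of_le hx.le,
      intervalIntegral.integral_const_mul, expAvg]

end ExpAvg

end Counterbalance

/-! ### Comparison of the densities weighted by the two squares. -/

namespace Counterbalance

open Set

/-- Indicators as test functions give the inequality almost everywhere, and continuity makes it
pointwise. Relations between laws thereby become relations between their continuous densities. -/
lemma le_of_forall_lintegral_le {f g : ℝ → ℝ} (hf : Continuous f) (hg : Continuous g)
    (hg0 : ∀ x, 0 ≤ g x)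
    (h : ∀ ψ : ℝ → ENNReal, Measurable ψ →
      ∫⁻ x, ENNReal.ofReal (f x) * ψ x ≤ ∫⁻ x, ENNReal.ofReal (g x) * ψ x) (x : ℝ) :
    f x ≤ g x := by
  have hae : (fun x => ENNReal.ofReal (f x)) ≤ᵐ[volume] fun x => ENNReal.ofReal (g x) := by
    refine ae_le_of_forall_setLIntegral_le_of_sigmaFinite (by fun_prop) fun s hs _ => ?_
    have := h (s.indicator 1) (measurable_one.indicator hs)
    rw [← lintegral_indicator hs, ← lintegral_indicator hs]
    refine (le_of_eq ?_).trans (this.trans (le_of_eq ?_)) <;>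
    · congr 1; ext y
      by_cases hy : y ∈ s <;> simp [hy]
  -- The inequality is recast as an equality of continuous functions, for which almost everywhere
  -- means everywhere.
  have hmax : (fun x => max (f x) (g x)) =ᵐ[volume] g := by
    filter_upwards [hae] with y hy
    exact max_eq_right ((ENNReal.ofReal_le_ofReal_iff (hg0 y)).1 hy)
  have := (Continuous.ae_eq_iff_eq volume (hf.max hg) hg).1 hmax
  exact max_eq_right_iff.1 (congrFun this x)

lemma lintegral_formLaw_cons_cons (a b : ℝ) (l : List ℝ) {ψ : ℝ → ENNReal} (hψ : Measurable ψ) :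
    ∫⁻ r, ψ r ∂formLaw (a :: b :: l) =
      ∫⁻ r, ∫⁻ x, ∫⁻ y, ψ (a * x ^ 2 + b * y ^ 2 + r) ∂stdNormal ∂stdNormal ∂formLaw l := by
  rw [lintegral_formLaw_cons a _ hψ]
  have h1 : ∀ x : ℝ, ∫⁻ r, ψ (a * x ^ 2 + r) ∂formLaw (b :: l) =
      ∫⁻ r, ∫⁻ y, ψ (a * x ^ 2 + b * y ^ 2 + r) ∂stdNormal ∂formLaw l := by
    intro x
    rw [lintegral_formLaw_cons b l (ψ := fun r => ψ (a * x ^ 2 + r)) (by fun_prop),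
      lintegral_lintegral_swap (by fun_prop)]
    simp_rw [add_assoc]
  simp_rw [h1]
  rw [lintegral_lintegral_swap]
  exact (by fun_prop : Measurable fun p : ℝ × ℝ =>
    ∫⁻ y, ψ (a * p.1 ^ 2 + b * y ^ 2 + p.2) ∂stdNormal).aemeasurable

lemma expAvg_nonneg_of_eq_zero {q : ℝ → ℝ} {c : ℝ} (hc : 0 ≤ c) (hq0 : ∀ t, 0 ≤ q t)
    (hqneg : ∀ t ≤ 0, q t = 0) (t : ℝ) : 0 ≤ expAvg c q t := by
  rcases le_total 0 t with h | h
  · exact expAvg_nonneg hc hq0 h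
  · have : ∫ s in (0 : ℝ)..t, q s * Real.exp (s / (2 * c)) = 0 := by
      refine intervalIntegral.integral_zero_ae (ae_of_all _ fun s hs => ?_)
      rw [uIoc_of_ge h] at hs
      rw [hqneg s hs.2, zero_mul]
    simp [expAvg, this]

section Densities

variable {a b : ℝ} (l : List ℝ)

/-- One-variable size biasing in y: the weight y² becomes an added b·u. -/
lemma lintegral_biasedDensity_snd (ha : 0 < a) (hb : 0 < b) {ψ : ℝ → ENNReal}
    (hψ : Measurable ψ) :
    ∫⁻ t, ENNReal.ofReal (biasedDensity 0 1 a b (formLaw l) t) * ψ t =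
      ∫⁻ r, ∫⁻ u, ψ (r + b * u) ∂chiSqTwo ∂formLaw (a :: b :: l) := by
  rw [lintegral_biasedDensity le_rfl zero_le_one ha hb hψ,
    lintegral_formLaw_cons_cons a b l (ψ := fun r => ∫⁻ u, ψ (r + b * u) ∂chiSqTwo) (by fun_prop)]
  congr 1; ext r
  congr 1; ext x
  have := lintegral_stdNormal_mul_sq (χ := fun s => ψ (a * x ^ 2 + s + r)) (by fun_prop) b
  simp only [zero_mul, one_mul, zero_add]
  rw [this]
  congr 1; ext y
  congr 1; ext u
  congr 1; ring

lemma lintegral_biasedDensity_fst (ha : 0 < a) (hb : 0 < b) {ψ : ℝ → ENNReal}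
    (hψ : Measurable ψ) :
    ∫⁻ t, ENNReal.ofReal (biasedDensity 1 0 a b (formLaw l) t) * ψ t =
      ∫⁻ r, ∫⁻ u, ψ (r + a * u) ∂chiSqTwo ∂formLaw (a :: b :: l) := by
  rw [lintegral_biasedDensity zero_le_one le_rfl ha hb hψ,
    lintegral_formLaw_cons_cons a b l (ψ := fun r => ∫⁻ u, ψ (r + a * u) ∂chiSqTwo) (by fun_prop)]
  congr 1; ext r
  rw [lintegral_lintegral_swap (by fun_prop)]
  conv_rhs => rw [lintegral_lintegral_swap (by
    exact (by fun_prop : Measurable fun p : ℝ × ℝ =>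
      ∫⁻ u, ψ (a * p.1 ^ 2 + b * p.2 ^ 2 + r + a * u) ∂chiSqTwo).aemeasurable)]
  congr 1; ext y
  have := lintegral_stdNormal_mul_sq (χ := fun s => ψ (s + b * y ^ 2 + r)) (by fun_prop) a
  simp only [zero_mul, one_mul, add_zero]
  rw [this]
  congr 1; ext x
  congr 1; ext u
  congr 1; ring

variable {l}

/-- Both sides are densities of Q plus exponential variables, related by
`lintegral_chiSqTwo_resolvent`. Equality holds; only this direction is needed. -/
lemma biasedDensity_resolvent (hl : ∀ c ∈ l, 0 ≤ c) (hb : 0 < b) (hab : b ≤ a) (t : ℝ) :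
    a * biasedDensity 1 0 a b (formLaw l) t ≤ b * biasedDensity 0 1 a b (formLaw l) t +
      (a - b) * expAvg a (biasedDensity 0 1 a b (formLaw l)) t := by
  have ha := hb.trans_le hab
  set q := biasedDensity 0 1 a b (formLaw l) with hqdef
  have hq : Continuous q := continuous_biasedDensity le_rfl zero_le_one ha hb
  have hq0 : ∀ t, 0 ≤ q t := biasedDensity_nonneg le_rfl zero_le_one
  have hqneg : ∀ t ≤ 0, q t = 0 := fun t ht => biasedDensity_of_nonpos (formLaw_nonneg hl) ht
  have hz : Continuous (expAvg a q) := continuous_expAvg hq a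
  have hz0 : ∀ t, 0 ≤ expAvg a q t := expAvg_nonneg_of_eq_zero ha.le hq0 hqneg
  have hd : 0 ≤ a - b := by linarith
  refine le_of_forall_lintegral_le (f := fun t => a * biasedDensity 1 0 a b (formLaw l) t)
    (g := fun t => b * q t + (a - b) * expAvg a q t)
    ((continuous_biasedDensity zero_le_one le_rfl ha hb).const_mul a)
    ((hq.const_mul b).add (hz.const_mul (a - b)))
    (fun t => add_nonneg (mul_nonneg hb.le (hq0 t)) (mul_nonneg hd (hz0 t))) (fun ψ hψ => ?_) t
  have e1 : ∫⁻ x, ENNReal.ofReal (a * biasedDensity 1 0 a b (formLaw l) x) * ψ x =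
      ENNReal.ofReal a * ∫⁻ x, ENNReal.ofReal (biasedDensity 1 0 a b (formLaw l) x) * ψ x := by
    rw [← lintegral_const_mul' _ _ ENNReal.ofReal_ne_top]
    simp_rw [ENNReal.ofReal_mul ha.le, mul_assoc]
  have e2 : ∫⁻ x, ENNReal.ofReal (b * q x + (a - b) * expAvg a q x) * ψ x =
      ENNReal.ofReal b * (∫⁻ x, ENNReal.ofReal (q x) * ψ x) +
        ENNReal.ofReal (a - b) * ∫⁻ x, ENNReal.ofReal (expAvg a q x) * ψ x := by
    have := hq.measurable
    have := hz.measurable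
    rw [← lintegral_const_mul' _ _ ENNReal.ofReal_ne_top,
      ← lintegral_const_mul' _ _ ENNReal.ofReal_ne_top, ← lintegral_add_left (by fun_prop)]
    congr 1; ext x
    rw [ENNReal.ofReal_add (mul_nonneg hb.le (hq0 x)) (mul_nonneg hd (hz0 x)),
      ENNReal.ofReal_mul hb.le, ENNReal.ofReal_mul hd]
    ring
  have e3 := lintegral_biasedDensity_snd l ha hb hψ
  have e4 := lintegral_biasedDensity_snd l ha hb (ψ := fun t => ∫⁻ u, ψ (t + a * u) ∂chiSqTwo)
    (by fun_prop)
  rw [← hqdef] at e3 e4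
  rw [e1, e2, lintegral_biasedDensity_fst l ha hb hψ, lintegral_expAvg hq hq0 hqneg ha hψ, e3, e4,
    ← lintegral_const_mul _ (by fun_prop), ← lintegral_const_mul _ (by fun_prop),
    ← lintegral_const_mul _ (by fun_prop), ← lintegral_add_left (by fun_prop)]
  refine le_of_eq ?_
  congr 1; ext r
  rw [lintegral_chiSqTwo_resolvent hb hab (χ := fun s => ψ (r + s)) (by fun_prop)]
  simp_rw [add_assoc]

/-- Here q is the density of R = Q + b u. Size biasing Q alone in E[Q ψ(R)] produces the averages of
q on the left; the right-hand side is E[R ψ(R)], and Q ≤ R. -/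
lemma biasedDensity_volterra (hl : ∀ c ∈ l, 0 ≤ c) (ha : 0 < a) (hb : 0 < b) (t : ℝ) :
    ((a :: b :: l).map fun c => c * expAvg c (biasedDensity 0 1 a b (formLaw l)) t).sum ≤
      t * biasedDensity 0 1 a b (formLaw l) t := by
  set q := biasedDensity 0 1 a b (formLaw l) with hqdef
  have hq : Continuous q := continuous_biasedDensity le_rfl zero_le_one ha hb
  have hq0 : ∀ t, 0 ≤ q t := biasedDensity_nonneg le_rfl zero_le_one
  have hqneg : ∀ t ≤ 0, q t = 0 := fun t ht => biasedDensity_of_nonpos (formLaw_nonneg hl) ht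
  have hl' : ∀ c ∈ a :: b :: l, 0 ≤ c := by
    simp only [List.mem_cons]
    rintro c (rfl | rfl | h)
    exacts [ha.le, hb.le, hl c h]
  -- The law keeps the full list L while the induction below runs over the list L' of summands.
  generalize hL : a :: b :: l = L at hl' ⊢
  have hz0 : ∀ c, 0 ≤ c → ∀ t, 0 ≤ expAvg c q t := fun c hc =>
    expAvg_nonneg_of_eq_zero hc hq0 hqneg
  refine le_of_forall_lintegral_le (f := fun t => (L.map fun c => c * expAvg c q t).sum)
    (g := fun t => t * q t)
    (continuous_list_sum _ fun c _ => (continuous_expAvg hq c).const_mul c)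
    (continuous_id.mul hq) (fun t => ?_) (fun ψ hψ => ?_) t
  · rcases le_total 0 t with h | h
    · exact mul_nonneg h (hq0 t)
    · rw [hqneg t h, mul_zero]
  have e1 : ∀ L' : List ℝ, (∀ c ∈ L', 0 ≤ c) →
      ∫⁻ x, ENNReal.ofReal (L'.map fun c => c * expAvg c q x).sum * ψ x =
      (L'.map fun c => ENNReal.ofReal c *
        ∫⁻ r, ∫⁻ u, ∫⁻ v, ψ (r + c * u + b * v) ∂chiSqTwo ∂chiSqTwo ∂formLaw L).sum := by
    intro L' hL'
    induction L' with
    | nil => simp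
    | cons c L' ih =>
      have hc : 0 ≤ c := hL' c (by simp)
      have hL'' : ∀ d ∈ L', 0 ≤ d := fun d hd => hL' d (by simp [hd])
      have hnn : ∀ x, 0 ≤ (L'.map fun c => c * expAvg c q x).sum := fun x =>
        List.sum_nonneg fun y hy => by
          obtain ⟨d, hd, rfl⟩ := List.mem_map.1 hy
          exact mul_nonneg (hL'' d hd) (hz0 d (hL'' d hd) x)
      have hcm := (continuous_expAvg hq c).measurable
      simp only [List.map_cons, List.sum_cons]
      rw [← ih hL'']
      have e3 : ENNReal.ofReal c * ∫⁻ r, ∫⁻ u, ∫⁻ v, ψ (r + c * u + b * v)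
          ∂chiSqTwo ∂chiSqTwo ∂formLaw L =
          ∫⁻ x, ENNReal.ofReal (c * expAvg c q x) * ψ x := by
        rcases hc.eq_or_lt with rfl | hc
        · simp
        simp_rw [ENNReal.ofReal_mul hc.le, mul_assoc]
        rw [lintegral_const_mul _ (by fun_prop), lintegral_expAvg hq hq0 hqneg hc hψ,
          lintegral_biasedDensity_snd l ha hb (ψ := fun t => ∫⁻ u, ψ (t + c * u) ∂chiSqTwo)
          (by fun_prop), hL]
        congr 2; ext r
        rw [lintegral_lintegral_swap (by fun_prop)]
        congr 1; ext u
        congr 1; ext v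
        congr 1; ring
      rw [e3, ← lintegral_add_left (by fun_prop)]
      congr 1; ext x
      rw [ENNReal.ofReal_add (mul_nonneg hc (hz0 c hc x)) (hnn x), add_mul]
  have e2 : ∫⁻ x, ENNReal.ofReal (x * q x) * ψ x =
      ∫⁻ r, ∫⁻ u, ENNReal.ofReal (r + b * u) * ψ (r + b * u) ∂chiSqTwo ∂formLaw L := by
    rw [← hL, ← lintegral_biasedDensity_snd l ha hb (ψ := fun r => ENNReal.ofReal r * ψ r)
      (by fun_prop)]
    congr 1; ext x
    rw [ENNReal.ofReal_mul' (hq0 x)]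
    ring
  rw [e1 L hl', e2, ← lintegral_formLaw_sizeBias hl' (ψ := fun r => ∫⁻ v, ψ (r + b * v) ∂chiSqTwo)
    (by fun_prop)]
  refine lintegral_mono fun r => ?_
  rw [← lintegral_const_mul _ (by fun_prop), lintegral_chiSqTwo (by fun_prop),
    lintegral_chiSqTwo (by fun_prop)]
  refine setLIntegral_mono (by fun_prop) fun u hu => ?_
  have hu : 0 < u := hu
  gcongr
  have := mul_pos hb hu
  linarith

/-- By the resolvent inequality, a·q_x ≤ b·q_y + (a−b)·E_a q_y, and E_a q_y ≤ q_y up to the mean by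
the Volterra comparison. -/
lemma biasedDensity_fst_le_snd (hl : ∀ c ∈ l, 0 ≤ c) (hb : 0 < b) (hab : b ≤ a)
    (hla : ∀ c ∈ l, c ≤ a) {t : ℝ}
    (ht : t ≤ a + b + l.sum) :
    biasedDensity 1 0 a b (formLaw l) t ≤ biasedDensity 0 1 a b (formLaw l) t := by
  have ha := hb.trans_le hab
  rcases le_or_gt t 0 with h0 | h0
  · rw [biasedDensity_of_nonpos (formLaw_nonneg hl) h0,
      biasedDensity_of_nonpos (formLaw_nonneg hl) h0]
  have hL : ∀ c ∈ a :: b :: l, 0 ≤ c ∧ c ≤ a := by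
    simp only [List.mem_cons]
    rintro c (rfl | rfl | h)
    exacts [⟨ha.le, le_rfl⟩, ⟨hb.le, hab⟩, ⟨hl c h, hla c h⟩]
  have h1 := expAvg_le_of_volterra (x := t) (l := a :: b :: l) (ε := 2 * b)
    (continuous_biasedDensity (ν := formLaw l) le_rfl zero_le_one ha hb)
    (biasedDensity_nonneg le_rfl zero_le_one)
    (fun s hs => biasedDensity_pos ha hb (fun ε hε => formLaw_Iio_pos hε) hs) ha hL
    (by positivity) (monotoneOn_biasedDensity le_rfl zero_le_one hb hab (formLaw_nonneg hl))
    (fun s _ => biasedDensity_volterra hl ha hb s)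
    ⟨h0.le, by simpa [add_assoc] using ht⟩
  have h2 := biasedDensity_resolvent hl hb hab t
  have h3 : 0 ≤ a - b := by linarith
  have h4 := mul_le_mul_of_nonneg_left h1 h3
  exact le_of_mul_le_mul_left (by linarith) ha

end Densities

end Counterbalance

/-! ### Merging coefficients of a quadratic form. -/

namespace Counterbalance

open Set

lemma chiSqTwo_Iic (t : ℝ) :
    chiSqTwo (Iic t) = ENNReal.ofReal (1 - Real.exp (-max t 0 / 2)) := by
  have hm : MeasurableSet (Iic t) := measurableSet_Iic
  rw [← lintegral_indicator_one hm, lintegral_chiSqTwo (measurable_one.indicator hm)]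
  rcases le_or_gt t 0 with ht | ht
  · have : ∫⁻ u in Ioi 0, ENNReal.ofReal (Real.exp (-u / 2) / 2) *
        (Iic t).indicator 1 u = ∫⁻ u in Ioi (0 : ℝ), 0 := by
      refine setLIntegral_congr_fun measurableSet_Ioi fun u hu => ?_
      have hu : 0 < u := hu
      rw [indicator_of_notMem (by simp only [mem_Iic]; linarith), mul_zero]
    rw [this, max_eq_right ht]
    simp
  · have : ∫⁻ u in Ioi 0, ENNReal.ofReal (Real.exp (-u / 2) / 2) *
        (Iic t).indicator 1 u =
        ∫⁻ u in Ioc 0 t, ENNReal.ofReal (Real.exp (-u / 2) / 2) := by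
      rw [← lintegral_indicator measurableSet_Ioi, ← lintegral_indicator measurableSet_Ioc]
      congr 1; ext u
      by_cases h1 : 0 < u
      · rw [indicator_of_mem (a := u) (s := Ioi 0) h1]
        by_cases h2 : u ≤ t
        · rw [indicator_of_mem (a := u) (s := Iic t) h2,
            indicator_of_mem (a := u) (s := Ioc 0 t) ⟨h1, h2⟩]
          simp
        · rw [indicator_of_notMem (a := u) (s := Iic t) h2,
            indicator_of_notMem (a := u) (s := Ioc 0 t) fun h => h2 h.2, mul_zero]
      · rw [indicator_of_notMem (a := u) (s := Ioi 0) h1,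
          indicator_of_notMem (a := u) (s := Ioc 0 t) fun h => h1 h.1]
    have hcont : Continuous fun u : ℝ => Real.exp (-u / 2) / 2 := by fun_prop
    rw [this, max_eq_left ht.le, ← ofReal_integral_eq_lintegral_ofReal
      (hcont.integrableOn_Icc.mono_set Ioc_subset_Icc_self) (ae_of_all _ fun u => by positivity),
      ← intervalIntegral.integral_of_le ht.le]
    congr 1
    have hder : ∀ u ∈ uIcc 0 t, HasDerivAt (fun u : ℝ => -Real.exp (-u / 2))
        (Real.exp (-u / 2) / 2) u := by
      intro u _
      refine (((hasDerivAt_id u).neg.div_const 2).exp.neg).congr_deriv ?_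
      simp only [Pi.neg_apply, id]
      ring
    rw [intervalIntegral.integral_eq_sub_of_hasDerivAt hder (hcont.intervalIntegrable _ _)]
    simp
    ring

/-- At the end of the merging path the second coefficient is 0, and the form vanishes exactly where
the cosine does. -/
lemma ae_angleLaw_cos_ne_zero : ∀ᵐ φ ∂angleLaw, Real.cos φ ≠ 0 := by
  have h : ∀ᵐ φ : ℝ, Real.cos φ ≠ 0 := by
    have hc : {φ : ℝ | Real.cos φ = 0}.Countable := by
      have : {φ : ℝ | Real.cos φ = 0} = range fun k : ℤ => (2 * (k : ℝ) + 1) * Real.pi / 2 := by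
        ext φ
        simp only [mem_ofPred_eq, Real.cos_eq_zero_iff, mem_range]
        exact exists_congr fun k => eq_comm
      rw [this]
      exact countable_range _
    rw [ae_iff]
    simpa using hc.measure_zero volume
  exact (Measure.ae_smul_measure (ae_restrict_of_ae h) _)

/-- The distribution function of `a x² + b y² + r`, written in polar coordinates. -/
noncomputable def pairCdf (a b : ℝ) (ν : Measure ℝ) (t : ℝ) : ℝ :=
  ∫ p, (1 - Real.exp (-max (t - p.2) 0 / (2 * angleForm a b p.1))) ∂(angleLaw.prod ν)

lemma measurable_pairCdf_integrand (a b t : ℝ) :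
    Measurable fun p : ℝ × ℝ =>
      1 - Real.exp (-max (t - p.2) 0 / (2 * angleForm a b p.1)) := by
  have := (continuous_angleForm a b).measurable
  fun_prop

lemma norm_pairCdf_integrand_le {a b : ℝ} (ha : 0 ≤ a) (hb : 0 ≤ b) (t : ℝ) (p : ℝ × ℝ) :
    ‖1 - Real.exp (-max (t - p.2) 0 / (2 * angleForm a b p.1))‖ ≤ 1 := by
  have hw := angleForm_nonneg ha hb p.1
  have h1 : Real.exp (-max (t - p.2) 0 / (2 * angleForm a b p.1)) ≤ 1 := by
    rw [Real.exp_le_one_iff]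
    exact div_nonpos_of_nonpos_of_nonneg (neg_nonpos.2 (le_max_right _ _)) (by positivity)
  rw [Real.norm_eq_abs, abs_le]
  constructor <;> linarith [Real.exp_pos (-max (t - p.2) 0 / (2 * angleForm a b p.1))]

lemma pairCdf_integrand_nonneg {a b : ℝ} (ha : 0 ≤ a) (hb : 0 ≤ b) (t : ℝ) (p : ℝ × ℝ) :
    0 ≤ 1 - Real.exp (-max (t - p.2) 0 / (2 * angleForm a b p.1)) := by
  have hw := angleForm_nonneg ha hb p.1
  rw [sub_nonneg, Real.exp_le_one_iff]
  exact div_nonpos_of_nonpos_of_nonneg (neg_nonpos.2 (le_max_right _ _)) (by positivity)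

lemma integrable_pairCdf_integrand {a b : ℝ} (ha : 0 ≤ a) (hb : 0 ≤ b) (ν : Measure ℝ)
    [IsProbabilityMeasure ν] (t : ℝ) :
    Integrable (fun p : ℝ × ℝ => 1 - Real.exp (-max (t - p.2) 0 / (2 * angleForm a b p.1)))
      (angleLaw.prod ν) :=
  Integrable.of_bound (measurable_pairCdf_integrand a b t).aestronglyMeasurable 1
    (ae_of_all _ (norm_pairCdf_integrand_le ha hb t))

lemma formLaw_Iic_eq_pairCdf {a b : ℝ} (ha : 0 < a) (hb : 0 ≤ b) (l : List ℝ) (t : ℝ) :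
    formLaw (a :: b :: l) (Iic t) = ENNReal.ofReal (pairCdf a b (formLaw l) t) := by
  have hm : Measurable ((Iic t).indicator (1 : ℝ → ENNReal)) :=
    measurable_one.indicator measurableSet_Iic
  rw [← lintegral_indicator_one measurableSet_Iic, lintegral_formLaw_cons_cons a b l hm, pairCdf,
    ofReal_integral_eq_lintegral_ofReal (integrable_pairCdf_integrand ha.le hb _ t)
    (ae_of_all _ (pairCdf_integrand_nonneg ha.le hb t)),
    lintegral_prod_symm _ (measurable_pairCdf_integrand a b t).ennreal_ofReal.aemeasurable]
  congr 1; ext r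
  rw [lintegral_stdNormal_pair_sq (F := fun x y => (Iic t).indicator 1 (a * x + b * y + r))
    (hm.comp (by fun_prop : Measurable fun p : ℝ × ℝ => a * p.1 + b * p.2 + r))]
  refine lintegral_congr_ae ?_
  filter_upwards [ae_angleLaw_cos_ne_zero] with φ hφ
  have hw : 0 < angleForm a b φ := by
    unfold angleForm
    have : 0 < Real.cos φ ^ 2 := by positivity
    positivity
  have h1 : ∀ u, (Iic t).indicator (1 : ℝ → ENNReal)
      (a * (u * Real.cos φ ^ 2) + b * (u * Real.sin φ ^ 2) + r) =
      (Iic ((t - r) / angleForm a b φ)).indicator 1 u := by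
    intro u
    have hiff : a * (u * Real.cos φ ^ 2) + b * (u * Real.sin φ ^ 2) + r ∈ Iic t ↔
        u ∈ Iic ((t - r) / angleForm a b φ) := by
      simp only [mem_Iic]
      rw [le_div_iff₀ hw, angleForm]
      constructor <;> intro h <;> linarith
    by_cases hu : u ∈ Iic ((t - r) / angleForm a b φ)
    · rw [indicator_of_mem (hiff.2 hu), indicator_of_mem hu]; rfl
    · rw [indicator_of_notMem (fun h => hu (hiff.1 h)), indicator_of_notMem hu]
  simp_rw [h1]
  rw [lintegral_indicator_one measurableSet_Iic, chiSqTwo_Iic]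
  congr 3
  have : max ((t - r) / angleForm a b φ) 0 = max (t - r) 0 / angleForm a b φ := by
    rcases le_total (t - r) 0 with h | h
    · rw [max_eq_right h, max_eq_right (div_nonpos_of_nonpos_of_nonneg h hw.le), zero_div]
    · rw [max_eq_left h, max_eq_left (div_nonneg h hw.le)]
  rw [this]
  field_simp

/-- Differentiation under the integral: the w-derivative of 1 − e^(-y/2w) is −`gammaTwo w y`, and w
changes at rate cos² − sin². -/
lemma hasDerivAt_pairCdf {a b : ℝ} (ν : Measure ℝ) [IsProbabilityMeasure ν] {s : ℝ}
    (hs : 0 < a + s) (hs' : 0 < b - s) (t : ℝ) :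
    HasDerivAt (fun s => pairCdf (a + s) (b - s) ν t)
      (biasedDensity 0 1 (a + s) (b - s) ν t - biasedDensity 1 0 (a + s) (b - s) ν t) s := by
  -- Within distance m of s both coefficients stay at least m, which gives the dominating constant
  -- 1/m.
  set m := min (a + s) (b - s) / 2 with hmdef
  have hm : 0 < m := half_pos (lt_min hs hs')
  have hm1 : 2 * m ≤ a + s := by rw [hmdef]; linarith [min_le_left (a + s) (b - s)]
  have hm2 : 2 * m ≤ b - s := by rw [hmdef]; linarith [min_le_right (a + s) (b - s)]
  have hball : ∀ u ∈ Metric.ball s m, ∀ φ, m ≤ angleForm (a + u) (b - u) φ := by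
    intro u hu φ
    rw [Metric.mem_ball, Real.dist_eq, abs_lt] at hu
    exact le_angleForm (by linarith) (by linarith) φ
  have hder := (hasDerivAt_integral_of_dominated_loc_of_deriv_le (μ := angleLaw.prod ν)
    (F := fun u p => 1 - Real.exp (-max (t - p.2) 0 / (2 * angleForm (a + u) (b - u) p.1)))
    (F' := fun u p => angleForm (-1) 1 p.1 *
      gammaTwo (angleForm (a + u) (b - u) p.1) (max (t - p.2) 0))
    (bound := fun _ => 1 / m) (Metric.ball_mem_nhds s hm)
    (Filter.Eventually.of_forall fun u =>
      (measurable_pairCdf_integrand (a + u) (b - u) t).aestronglyMeasurable)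
    (integrable_pairCdf_integrand hs.le hs'.le ν t)
    ((measurable_biasedDensity_integrand (-1) 1 (a + s) (b - s)).comp
      measurable_prodMk_left).aestronglyMeasurable
    (ae_of_all _ fun p u hu => ?_) (integrable_const _) (ae_of_all _ fun p u hu => ?_)).2
  · refine hder.congr_deriv ?_
    rw [biasedDensity, biasedDensity, ← integral_sub
      (integrable_biasedDensity_integrand le_rfl zero_le_one hs hs' t)
      (integrable_biasedDensity_integrand zero_le_one le_rfl hs hs' t)]
    congr 1; ext p
    simp only [angleForm]
    ring
  · have hw := hball u hu p.1
    have hwpos := hm.trans_le hw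
    rw [norm_mul, Real.norm_of_nonneg (gammaTwo_nonneg (le_max_right _ _))]
    have h1 : ‖angleForm (-1) 1 p.1‖ ≤ 1 := by
      rw [Real.norm_eq_abs, abs_le]
      exact ⟨le_angleForm (by norm_num) (by norm_num) _, angleForm_le (by norm_num) le_rfl _⟩
    calc _ ≤ 1 * (1 / m) := mul_le_mul h1 ((gammaTwo_le hwpos).trans
          (one_div_le_one_div_of_le hm hw)) (gammaTwo_nonneg (le_max_right _ _)) zero_le_one
      _ = 1 / m := one_mul _
  · have hwpos := hm.trans_le (hball u hu p.1)
    have hw : HasDerivAt (fun u => 2 * angleForm (a + u) (b - u) p.1)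
        (-(2 * angleForm (-1) 1 p.1)) u := by
      have h1 : HasDerivAt (fun u => (a + u) * Real.cos p.1 ^ 2) (1 * Real.cos p.1 ^ 2) u :=
        ((hasDerivAt_id u).const_add a).mul_const _
      have h2 : HasDerivAt (fun u => (b - u) * Real.sin p.1 ^ 2) (-1 * Real.sin p.1 ^ 2) u :=
        ((hasDerivAt_id u).const_sub b).mul_const _
      refine ((h1.add h2).const_mul 2).congr_deriv ?_
      simp only [angleForm]
      ring
    have h3 := ((((hasDerivAt_const u (-max (t - p.2) 0)).div hw (by positivity)).exp).const_sub 1)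
    refine h3.congr_deriv ?_
    simp only [gammaTwo, Pi.div_apply]
    field_simp
    ring

lemma continuousOn_pairCdf {a b : ℝ} (ν : Measure ℝ) [IsProbabilityMeasure ν] (ha : 0 < a)
    (t : ℝ) : ContinuousOn (fun s => pairCdf (a + s) (b - s) ν t) (Icc 0 b) := by
  refine continuousOn_of_dominated (bound := fun _ => 1)
    (fun s _ => (measurable_pairCdf_integrand (a + s) (b - s) t).aestronglyMeasurable)
    (fun s hs => ae_of_all _ (norm_pairCdf_integrand_le (by linarith [hs.1]) (by linarith [hs.2]) t))
    (integrable_const _) ?_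
  filter_upwards [Measure.quasiMeasurePreserving_fst.ae ae_angleLaw_cos_ne_zero] with p hp
  have hne : ∀ s ∈ Icc 0 b, 2 * angleForm (a + s) (b - s) p.1 ≠ 0 := by
    intro s hs
    have h1 : 0 < a + s := by linarith [hs.1]
    have h2 : 0 ≤ b - s := by linarith [hs.2]
    have : 0 < Real.cos p.1 ^ 2 := by positivity
    unfold angleForm
    positivity
  have hc : Continuous fun s => 2 * angleForm (a + s) (b - s) p.1 := by
    unfold angleForm; fun_prop
  exact continuousOn_const.sub
    (Real.continuous_exp.comp_continuousOn (continuousOn_const.div hc.continuousOn hne))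

/-- Merging a coefficient into the largest one increases the distribution function of a positive
Gaussian quadratic form at the points below its mean. -/
lemma formLaw_merge {a b : ℝ} {l : List ℝ} (hb : 0 < b) (hab : b ≤ a)
    (hl : ∀ c ∈ l, 0 ≤ c ∧ c ≤ a) {t : ℝ} (ht : t ≤ a + b + l.sum) :
    formLaw (a :: b :: l) (Iic t) ≤ formLaw ((a + b) :: l) (Iic t) := by
  have ha := hb.trans_le hab
  have h0 : formLaw ((a + b) :: l) = formLaw ((a + b) :: 0 :: l) := by
    have : sqLaw 0 = Measure.dirac 0 := by
      simp [sqLaw]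
    simp [formLaw, this]
  rw [h0, formLaw_Iic_eq_pairCdf ha hb.le, formLaw_Iic_eq_pairCdf (by linarith) le_rfl]
  refine ENNReal.ofReal_le_ofReal ?_
  have hder : ∀ s ∈ interior (Icc 0 b), HasDerivAt (fun s => pairCdf (a + s) (b - s) (formLaw l) t)
      (biasedDensity 0 1 (a + s) (b - s) (formLaw l) t -
        biasedDensity 1 0 (a + s) (b - s) (formLaw l) t) s := by
    intro s hs
    rw [interior_Icc] at hs
    exact hasDerivAt_pairCdf _ (by linarith [hs.1]) (by linarith [hs.2]) t
  have hmono : MonotoneOn (fun s => pairCdf (a + s) (b - s) (formLaw l) t) (Icc 0 b) := by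
    refine monotoneOn_of_deriv_nonneg (convex_Icc _ _) (continuousOn_pairCdf _ ha t)
      (fun s hs => (hder s hs).differentiableAt.differentiableWithinAt) fun s hs => ?_
    rw [(hder s hs).deriv, sub_nonneg]
    rw [interior_Icc] at hs
    -- Along the path the mean is unchanged and a + s remains the largest coefficient.
    exact biasedDensity_fst_le_snd (fun c hc => (hl c hc).1) (by linarith [hs.2])
      (by linarith [hs.1]) (fun c hc => by linarith [(hl c hc).2, hs.1]) (by linarith)
  have := hmono (left_mem_Icc.2 hb.le) (right_mem_Icc.2 hb.le) hb.le
  simpa using this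

/-- Among the positive Gaussian quadratic forms of a given mean, the distribution function below
the mean is largest for the square of a single normal variable. -/
theorem formLaw_Iic_le_sqLaw {a : ℝ} {l : List ℝ} (ha : 0 < a) (hl : ∀ c ∈ l, 0 ≤ c ∧ c ≤ a)
    {t : ℝ} (ht : t ≤ a + l.sum) :
    formLaw (a :: l) (Iic t) ≤ sqLaw (a + l.sum) (Iic t) := by
  induction l generalizing a with
  | nil => simp [formLaw]
  | cons b l ih =>
    obtain ⟨hb0, hba⟩ := hl b (by simp)
    have hl' : ∀ c ∈ l, 0 ≤ c ∧ c ≤ a := fun c hc => hl c (by simp [hc])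
    rw [List.sum_cons, ← add_assoc] at ht ⊢
    have h1 : formLaw (a :: b :: l) (Iic t) ≤ formLaw ((a + b) :: l) (Iic t) := by
      rcases hb0.eq_or_lt with rfl | hb
      · have : sqLaw 0 = Measure.dirac 0 := by
          simp [sqLaw]
        simp [formLaw, this]
      · exact formLaw_merge hb hba hl' ht
    exact h1.trans (ih (by linarith) (fun c hc => ⟨(hl' c hc).1, by linarith [(hl' c hc).2]⟩) ht)

end Counterbalance

/-! ### The χ²₁ distribution function, the ratio law and convolutions. -/

namespace Counterbalance

open Set

/-- The density of the chi-squared law with one degree of freedom; it vanishes on `(-∞, 0]`. -/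
noncomputable def chiSqDensity (y : ℝ) : ℝ := Real.exp (-y / 2) / √(2 * Real.pi * y)

lemma chiSqDensity_nonneg (y : ℝ) : 0 ≤ chiSqDensity y := by unfold chiSqDensity; positivity

/-- The conventions that the root of a nonpositive number is 0 and that division by 0 gives 0
replace a case split. -/
lemma chiSqDensity_of_nonpos {y : ℝ} (hy : y ≤ 0) : chiSqDensity y = 0 := by
  rw [chiSqDensity, Real.sqrt_eq_zero_of_nonpos, div_zero]
  exact mul_nonpos_of_nonneg_of_nonpos (by positivity) hy

@[fun_prop]
lemma measurable_chiSqDensity : Measurable chiSqDensity := by unfold chiSqDensity; fun_prop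

lemma chiSqDensity_anti {x y : ℝ} (hx : 0 < x) (hxy : x ≤ y) : chiSqDensity y ≤ chiSqDensity x := by
  unfold chiSqDensity
  have := Real.pi_pos
  gcongr

lemma lintegral_stdNormal_sq_eq_density {χ : ℝ → ENNReal} (hχ : Measurable χ) :
    ∫⁻ z, χ (z ^ 2) ∂stdNormal = ∫⁻ y, ENNReal.ofReal (chiSqDensity y) * χ y := by
  rw [lintegral_stdNormal_sq hχ, ← lintegral_indicator measurableSet_Ioi]
  congr 1; ext y
  by_cases hy : 0 < y
  · rw [indicator_of_mem (s := Ioi 0) hy]; rfl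
  · rw [indicator_of_notMem (s := Ioi 0) hy, chiSqDensity_of_nonpos (not_lt.1 hy)]
    simp

lemma sqLaw_one_eq_withDensity :
    sqLaw 1 = volume.withDensity fun y => ENNReal.ofReal (chiSqDensity y) := by
  ext s hs
  rw [← lintegral_indicator_one hs, lintegral_sqLaw _ (measurable_one.indicator hs),
    withDensity_apply _ hs, ← lintegral_indicator hs]
  simp_rw [one_mul]
  rw [lintegral_stdNormal_sq_eq_density (measurable_one.indicator hs)]
  congr 1; ext y
  by_cases hy : y ∈ s <;> simp [hy]

lemma integrable_chiSqDensity : Integrable chiSqDensity := by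
  rw [← lintegral_ofReal_ne_top_iff_integrable measurable_chiSqDensity.aestronglyMeasurable
    (ae_of_all _ chiSqDensity_nonneg)]
  have := lintegral_stdNormal_sq_eq_density (χ := fun _ => 1) measurable_const
  simp only [mul_one, lintegral_one, measure_univ] at this
  rw [← this]
  exact ENNReal.one_ne_top

lemma weightedChiSq_eq_conv (α : ℝ) : weightedChiSq α = (sqLaw 1).conv (sqLaw α) := by
  rw [weightedChiSq, Measure.conv, sqLaw, sqLaw, Measure.map_prod_map _ _ (by fun_prop)
    (by fun_prop), Measure.map_map (by fun_prop) (by fun_prop)]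
  congr 1
  ext z
  simp [Prod.map]

instance (α : ℝ) : IsProbabilityMeasure (weightedChiSq α) := by
  rw [weightedChiSq_eq_conv]; infer_instance

lemma weightedChiSq_zero : weightedChiSq 0 = sqLaw 1 := by
  have : sqLaw 0 = Measure.dirac 0 := by simp [sqLaw]
  rw [weightedChiSq_eq_conv, this, Measure.conv_dirac_zero]

lemma ofReal_chiSqCdf (t : ℝ) : ENNReal.ofReal (chiSqCdf t) = stdNormal {z | z ^ 2 ≤ t} := by
  rw [chiSqCdf, weightedChiSqCdf, weightedChiSq_zero, ofReal_measureReal, sqLaw,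
    Measure.map_apply (by fun_prop) measurableSet_Iic]
  simp only [one_mul]
  rfl

lemma chiSqCdf_nonneg (t : ℝ) : 0 ≤ chiSqCdf t := measureReal_nonneg

lemma chiSqCdf_le_one (t : ℝ) : chiSqCdf t ≤ 1 := measureReal_le_one

lemma chiSqCdf_mono : Monotone chiSqCdf := fun _ _ h => measureReal_mono (Iic_subset_Iic.2 h)

lemma chiSqCdf_eq_integral {t : ℝ} (ht : 0 ≤ t) :
    chiSqCdf t = ∫ y in (0 : ℝ)..t, chiSqDensity y := by
  rw [chiSqCdf, weightedChiSqCdf, weightedChiSq_zero, Measure.real, sqLaw_one_eq_withDensity,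
    withDensity_apply _ measurableSet_Iic, ← ofReal_integral_eq_lintegral_ofReal
    integrable_chiSqDensity.integrableOn (ae_of_all _ chiSqDensity_nonneg),
    ENNReal.toReal_ofReal (integral_nonneg chiSqDensity_nonneg),
    intervalIntegral.integral_of_le ht]
  refine setIntegral_eq_of_subset_of_forall_sdiff_eq_zero measurableSet_Iic Ioc_subset_Iic_self
    fun y hy => chiSqDensity_of_nonpos ?_
  by_contra! h
  exact hy.2 ⟨h, hy.1⟩

/-- The density is decreasing on the positive half-line. -/
lemma concaveOn_chiSqCdf : ConcaveOn ℝ (Ici 0) chiSqCdf := by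
  have hder : ∀ t, 0 < t →
      HasDerivAt (fun t => ∫ y in (0 : ℝ)..t, chiSqDensity y) (chiSqDensity t) t := by
    intro t ht
    refine intervalIntegral.integral_hasDerivAt_right
      integrable_chiSqDensity.intervalIntegrable
      measurable_chiSqDensity.stronglyMeasurable.stronglyMeasurableAtFilter ?_
    have : √(2 * Real.pi * t) ≠ 0 := by positivity
    unfold chiSqDensity
    exact ContinuousAt.div (by fun_prop) (by fun_prop) this
  have h : ConcaveOn ℝ (Ici 0) fun t => ∫ y in (0 : ℝ)..t, chiSqDensity y := by
    refine AntitoneOn.concaveOn_of_deriv (convex_Ici 0)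
      (intervalIntegral.continuous_primitive
        (fun _ _ => integrable_chiSqDensity.intervalIntegrable) 0).continuousOn ?_ ?_
    · rw [interior_Ici]
      exact fun t ht => (hder t ht).differentiableAt.differentiableWithinAt
    · rw [interior_Ici]
      intro x hx y hy hxy
      rw [(hder x hx).deriv, (hder y hy).deriv]
      exact chiSqDensity_anti hx hxy
  exact h.congr fun t ht => (chiSqCdf_eq_integral ht).symm

lemma continuousOn_chiSqCdf : ContinuousOn chiSqCdf (Ici 0) :=
  (intervalIntegral.continuous_primitive
    (fun _ _ => integrable_chiSqDensity.intervalIntegrable) 0).continuousOn.congr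
    fun _ ht => chiSqCdf_eq_integral ht

/-- Jensen's inequality for the chi-squared distribution function. -/
lemma lintegral_chiSqCdf_le {Ω : Type*} [MeasurableSpace Ω] {μ : Measure Ω}
    [IsProbabilityMeasure μ] {W : Ω → ℝ} (hW0 : ∀ ω, 0 ≤ W ω) (hW : Integrable W μ) :
    ∫⁻ ω, ENNReal.ofReal (chiSqCdf (W ω)) ∂μ ≤ ENNReal.ofReal (chiSqCdf (∫ ω, W ω ∂μ)) := by
  have hint : Integrable (fun ω => chiSqCdf (W ω)) μ :=
    Integrable.of_bound (chiSqCdf_mono.measurable.comp_aemeasurable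
      hW.aemeasurable).aestronglyMeasurable 1 (ae_of_all _ fun ω => by
        rw [Real.norm_of_nonneg (chiSqCdf_nonneg _)]
        exact chiSqCdf_le_one _)
  rw [← ofReal_integral_eq_lintegral_ofReal hint (ae_of_all _ fun ω => chiSqCdf_nonneg _)]
  exact ENNReal.ofReal_le_ofReal (concaveOn_chiSqCdf.le_map_integral continuousOn_chiSqCdf
    isClosed_Ici (ae_of_all _ hW0) hW hint)

/-- The law of `z² / (β + z²)` for a standard normal `z`. -/
noncomputable def ratioLaw (β : ℝ) : Measure ℝ := stdNormal.map fun z => z ^ 2 / (β + z ^ 2)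

instance (β : ℝ) : IsProbabilityMeasure (ratioLaw β) :=
  Measure.isProbabilityMeasure_map (by fun_prop)

lemma ratioLaw_Iic {β t : ℝ} (hβ : 0 ≤ β) (ht0 : 0 ≤ t) (ht1 : t < 1) :
    ratioLaw β (Iic t) = ENNReal.ofReal (chiSqCdf (β * t / (1 - t))) := by
  rw [ofReal_chiSqCdf, ratioLaw, Measure.map_apply (by fun_prop) measurableSet_Iic]
  congr 1; ext z
  simp only [mem_preimage, mem_Iic, mem_ofPred_eq]
  rcases eq_or_ne z 0 with rfl | hz
  · have h1 : 0 ≤ β * t / (1 - t) := div_nonneg (by positivity) (by linarith)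
    simp [ht0, h1]
  · have h1 : 0 < β + z ^ 2 := by positivity
    rw [div_le_iff₀ h1, le_div_iff₀ (by linarith)]
    constructor <;> intro h <;> linarith

lemma ratioLaw_Iio_zero {β : ℝ} (hβ : 0 ≤ β) : ratioLaw β (Iio 0) = 0 := by
  rw [ratioLaw, Measure.map_apply (by fun_prop) measurableSet_Iio]
  convert measure_empty (μ := stdNormal)
  ext z
  simp only [mem_preimage, mem_Iio, mem_empty_iff_false, iff_false, not_lt]
  positivity

lemma conv_Iic (μ ν : Measure ℝ) [SFinite ν] (t : ℝ) :
    (μ.conv ν) (Iic t) = ∫⁻ x, ν (Iic (t - x)) ∂μ := by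
  rw [← lintegral_indicator_one measurableSet_Iic,
    Measure.lintegral_conv (measurable_one.indicator measurableSet_Iic)]
  congr 1; ext x
  rw [← lintegral_indicator_one measurableSet_Iic]
  congr 1; ext y
  have : x + y ∈ Iic t ↔ y ∈ Iic (t - x) := by
    simp only [mem_Iic]; constructor <;> intro h <;> linarith
  by_cases h : y ∈ Iic (t - x)
  · rw [indicator_of_mem h, indicator_of_mem (this.2 h)]; rfl
  · rw [indicator_of_notMem h, indicator_of_notMem fun h' => h (this.1 h')]

/-- Subtracting a nonnegative variable from t only leads to points s ≤ t, so a comparison valid up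
to t is enough. -/
lemma conv_Iic_mono {μ₁ μ₂ ν : Measure ℝ} [SFinite μ₁] [SFinite μ₂] [SFinite ν] {t : ℝ}
    (hν : ν (Iio 0) = 0) (h : ∀ s ≤ t, μ₁ (Iic s) ≤ μ₂ (Iic s)) :
    (μ₁.conv ν) (Iic t) ≤ (μ₂.conv ν) (Iic t) := by
  rw [Measure.conv_comm μ₁, Measure.conv_comm μ₂, conv_Iic, conv_Iic]
  refine lintegral_mono_ae ?_
  have : ∀ᵐ x ∂ν, 0 ≤ x := by
    rw [ae_iff]; simpa [Iio] using hν
  filter_upwards [this] with x hx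
  exact h _ (by linarith)

lemma integrableOn_chiSqCdf_mul {β : ℝ} {f : ℝ → ℝ} {s : Set ℝ} (hf : IntegrableOn f s) :
    IntegrableOn (fun t => chiSqCdf (β * t / (1 - t)) * f t) s := by
  refine hf.bdd_mul (c := 1) (chiSqCdf_mono.measurable.comp (by fun_prop)).aestronglyMeasurable
    (ae_of_all _ fun t => ?_)
  rw [Real.norm_of_nonneg (chiSqCdf_nonneg _)]
  exact chiSqCdf_le_one _

/-- Condition on the variable s of law μ, insert the distribution function of the ratio at τ − s,
and substitute t = τ − s. -/
lemma conv_ratioLaw_Iic {μ : Measure ℝ} [IsFiniteMeasure μ] (hμ : μ ≪ volume)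
    (hμ0 : μ (Iio 0) = 0) {β τ : ℝ} (hβ : 0 ≤ β) (hτ0 : 0 < τ) (hτ1 : τ ≤ 1) :
    (μ.conv (ratioLaw β)) (Iic τ) = ENNReal.ofReal (∫ t in (0 : ℝ)..τ,
      chiSqCdf (β * t / (1 - t)) * (μ.rnDeriv volume (τ - t)).toReal) := by
  set p : ℝ → ℝ := fun s => (μ.rnDeriv volume s).toReal with hp
  have hpint : Integrable p := Measure.integrable_toReal_rnDeriv
  have hp' : ∀ᵐ s, μ.rnDeriv volume s = ENNReal.ofReal (p s) := by
    filter_upwards [Measure.rnDeriv_lt_top μ volume] with s hs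
    rw [hp, ENNReal.ofReal_toReal hs.ne]
  -- Strict positivity keeps τ − s below 1 even when τ = 1, as `ratioLaw_Iic` requires.
  have hμpos : ∀ᵐ s ∂μ, 0 < s := by
    have h1 : ∀ᵐ s ∂μ, 0 ≤ s := by
      rw [ae_iff]; simpa [Iio] using hμ0
    have h2 : ∀ᵐ s ∂μ, s ≠ 0 := hμ.ae_le (by
      have : ∀ᵐ s : ℝ, s ≠ 0 := by
        rw [ae_iff]; simp
      exact this)
    filter_upwards [h1, h2] with s hs hs'
    exact lt_of_le_of_ne hs hs'.symm
  have hm : Measurable fun s => ENNReal.ofReal (chiSqCdf (β * (τ - s) / (1 - (τ - s)))) :=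
    (chiSqCdf_mono.measurable.comp (by fun_prop)).ennreal_ofReal
  rw [conv_Iic]
  have h1 : ∀ᵐ s ∂μ, ratioLaw β (Iic (τ - s)) =
      (Ioc 0 τ).indicator (fun s => ENNReal.ofReal (chiSqCdf (β * (τ - s) / (1 - (τ - s))))) s := by
    filter_upwards [hμpos] with s hs
    by_cases h : s ≤ τ
    · rw [indicator_of_mem (s := Ioc 0 τ) ⟨hs, h⟩, ratioLaw_Iic hβ (by linarith) (by linarith)]
    · rw [indicator_of_notMem fun h' => h h'.2]
      exact measure_mono_null (fun y (hy : y ≤ τ - s) => show y < 0 by linarith)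
        (ratioLaw_Iio_zero hβ)
  rw [lintegral_congr_ae h1, ← lintegral_rnDeriv_mul hμ
    (hm.indicator measurableSet_Ioc).aemeasurable]
  have h2 : ∀ᵐ s, μ.rnDeriv volume s * (Ioc 0 τ).indicator
      (fun s => ENNReal.ofReal (chiSqCdf (β * (τ - s) / (1 - (τ - s))))) s =
      (Ioc 0 τ).indicator
        (fun s => ENNReal.ofReal (chiSqCdf (β * (τ - s) / (1 - (τ - s))) * p s)) s := by
    filter_upwards [hp'] with s hs
    by_cases h : s ∈ Ioc 0 τ
    · rw [indicator_of_mem h, indicator_of_mem h, hs, mul_comm,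
        ENNReal.ofReal_mul (chiSqCdf_nonneg _)]
    · rw [indicator_of_notMem h, indicator_of_notMem h, mul_zero]
  have hint : IntegrableOn (fun s => chiSqCdf (β * (τ - s) / (1 - (τ - s))) * p s) (Ioc 0 τ) := by
    refine hpint.integrableOn.bdd_mul (c := 1)
      (chiSqCdf_mono.measurable.comp (by fun_prop)).aestronglyMeasurable (ae_of_all _ fun t => ?_)
    rw [Real.norm_of_nonneg (chiSqCdf_nonneg _)]
    exact chiSqCdf_le_one _
  rw [lintegral_congr_ae h2, lintegral_indicator measurableSet_Ioc,
    ← ofReal_integral_eq_lintegral_ofReal hint (ae_of_all _ fun s =>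
      mul_nonneg (chiSqCdf_nonneg _) ENNReal.toReal_nonneg),
    ← intervalIntegral.integral_of_le hτ0.le]
  congr 1
  have := intervalIntegral.integral_comp_sub_left (a := 0) (b := τ)
    (fun t => chiSqCdf (β * t / (1 - t)) * p (τ - t)) τ
  simp only [sub_sub_cancel, sub_self, sub_zero] at this
  exact this

lemma sqLaw_nonneg {c : ℝ} (hc : 0 ≤ c) : sqLaw c (Iio 0) = 0 := by
  have := formLaw_nonneg (l := [c]) (by simpa using hc)
  simpa [formLaw] using this

lemma sqLaw_one_absolutelyContinuous : sqLaw 1 ≪ volume := by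
  rw [sqLaw_one_eq_withDensity]
  exact withDensity_absolutelyContinuous _ _

lemma weightedChiSq_absolutelyContinuous (α : ℝ) : weightedChiSq α ≪ volume := by
  rw [weightedChiSq_eq_conv, Measure.conv_comm]
  exact Measure.conv_absolutelyContinuous sqLaw_one_absolutelyContinuous

lemma weightedChiSq_nonneg {α : ℝ} (hα : 0 ≤ α) : weightedChiSq α (Iio 0) = 0 := by
  have := formLaw_nonneg (l := [1, α]) (by simpa using hα)
  simpa [formLaw, weightedChiSq_eq_conv] using this

/-- A Radon–Nikodym derivative is determined only up to null sets, which is harmless under the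
integrals. -/
lemma weightedChiSqPdf_zero_ae : weightedChiSqPdf 0 =ᵐ[volume] chiSqDensity := by
  have h := Measure.rnDeriv_withDensity (volume : Measure ℝ)
    (f := fun y => ENNReal.ofReal (chiSqDensity y)) (by fun_prop)
  rw [← sqLaw_one_eq_withDensity, ← weightedChiSq_zero] at h
  filter_upwards [h] with y hy
  rw [weightedChiSqPdf, hy, ENNReal.toReal_ofReal (chiSqDensity_nonneg y)]

lemma conv_weightedChiSq_Iic {α β τ : ℝ} (hα : 0 ≤ α) (hβ : 0 ≤ β) (hτ0 : 0 < τ) (hτ1 : τ ≤ 1) :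
    ((weightedChiSq α).conv (ratioLaw β)) (Iic τ) = ENNReal.ofReal (∫ t in (0 : ℝ)..τ,
      chiSqCdf (β * t / (1 - t)) * weightedChiSqPdf α (τ - t)) :=
  conv_ratioLaw_Iic (weightedChiSq_absolutelyContinuous α) (weightedChiSq_nonneg hα) hβ hτ0 hτ1

/-- Replacing the argument of the decreasing density by a smaller one increases the integral. -/
lemma integral_chiSqCdf_mul_pdf_le {β τ ρ : ℝ} (hτ0 : 0 < τ) (hρ : 1 ≤ ρ) :
    ∫ t in (0 : ℝ)..τ, chiSqCdf (β * t / (1 - t)) * weightedChiSqPdf 0 (τ - t) ≤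
      ∫ t in (0 : ℝ)..τ, chiSqCdf (β * t / (1 - t)) * weightedChiSqPdf 0 ((τ - t) / ρ) := by
  have hρ0 : ρ ≠ 0 := by linarith
  have hint : Integrable (weightedChiSqPdf 0) := Measure.integrable_toReal_rnDeriv
  have hae1 : ∀ᵐ t, weightedChiSqPdf 0 (τ - t) = chiSqDensity (τ - t) :=
    (quasiMeasurePreserving_sub_left volume τ).ae weightedChiSqPdf_zero_ae
  have hae2 : ∀ᵐ t, weightedChiSqPdf 0 ((τ - t) / ρ) = chiSqDensity ((τ - t) / ρ) := by
    have hdiv : Measure.QuasiMeasurePreserving (fun s : ℝ => s / ρ) volume volume := by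
      refine ⟨by fun_prop, ?_⟩
      have : (fun s : ℝ => s / ρ) = fun s => ρ⁻¹ * s := by ext s; ring
      rw [this, Real.map_volume_mul_left (inv_ne_zero hρ0)]
      exact Measure.smul_absolutelyContinuous
    exact (quasiMeasurePreserving_sub_left volume τ).ae (hdiv.ae weightedChiSqPdf_zero_ae)
  rw [intervalIntegral.integral_of_le hτ0.le, intervalIntegral.integral_of_le hτ0.le,
    integral_Ioc_eq_integral_Ioo, integral_Ioc_eq_integral_Ioo]
  refine setIntegral_mono_on_ae
    (integrableOn_chiSqCdf_mul (hint.comp_sub_left τ).integrableOn)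
    (integrableOn_chiSqCdf_mul ((hint.comp_div hρ0).comp_sub_left τ).integrableOn)
    measurableSet_Ioo ?_
  filter_upwards [hae1, hae2] with t h1 h2 ht
  rw [h1, h2]
  refine mul_le_mul_of_nonneg_left (chiSqDensity_anti ?_ ?_) (chiSqCdf_nonneg _)
  · exact div_pos (by linarith [ht.2]) (by linarith)
  · exact div_le_self (by linarith [ht.2]) hρ

end Counterbalance

/-! ### Families of independent normals and the conditional bound on the ratio. -/

namespace Counterbalance

open Set

lemma lintegral_stdNormal_sq_self : ∫⁻ z, ENNReal.ofReal (z ^ 2) ∂stdNormal = 1 := by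
  have := lintegral_stdNormal_sq_mul (χ := fun _ => 1) measurable_const
  simpa using this

lemma integrable_stdNormal_sq : Integrable (fun z : ℝ => z ^ 2) stdNormal := by
  rw [← lintegral_ofReal_ne_top_iff_integrable (by fun_prop) (ae_of_all _ fun z => by positivity),
    lintegral_stdNormal_sq_self]
  exact ENNReal.one_ne_top

lemma integral_stdNormal_sq : ∫ z, z ^ 2 ∂stdNormal = 1 := by
  rw [integral_eq_lintegral_of_nonneg_ae (ae_of_all _ fun z => by positivity) (by fun_prop),
    lintegral_stdNormal_sq_self, ENNReal.toReal_one]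

variable {ι : Type*} [Fintype ι]

/-- The law of a family of independent standard normal variables. -/
noncomputable abbrev piNormal (ι : Type*) [Fintype ι] : Measure (ι → ℝ) :=
  Measure.pi fun _ => stdNormal

lemma iIndepFun_mul_sq (μ : ι → ℝ) :
    iIndepFun (fun i (x : ι → ℝ) => μ i * x i ^ 2) (piNormal ι) :=
  iIndepFun_pi (X := fun i (z : ℝ) => μ i * z ^ 2) fun i => by fun_prop

lemma map_piNormal_mul_sq (c : ℝ) (i : ι) :
    (piNormal ι).map (fun x => c * x i ^ 2) = sqLaw c := by
  rw [sqLaw, ← (measurePreserving_eval (fun _ : ι => stdNormal) i).map_eq,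
    Measure.map_map (by fun_prop) (by fun_prop)]
  rfl

lemma map_piNormal_sum_insert [DecidableEq ι] (μ : ι → ℝ) {s : Finset ι} {i : ι} (hi : i ∉ s) :
    (piNormal ι).map (fun x => ∑ j ∈ insert i s, μ j * x j ^ 2) =
      (sqLaw (μ i)).conv ((piNormal ι).map fun x => ∑ j ∈ s, μ j * x j ^ 2) := by
  have hind := (iIndepFun_mul_sq μ).indepFun_finsetSum_of_notMem (fun j => by fun_prop) hi
  have hm : ∀ j, Measurable fun x : ι → ℝ => μ j * x j ^ 2 := fun j => by fun_prop
  have e1 : (fun x : ι → ℝ => ∑ j ∈ insert i s, μ j * x j ^ 2) =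
      (fun x => μ i * x i ^ 2) + fun x : ι → ℝ => ∑ j ∈ s, μ j * x j ^ 2 := by
    ext x
    rw [Finset.sum_insert hi, Pi.add_apply]
  have e2 : (∑ j ∈ s, fun x : ι → ℝ => μ j * x j ^ 2) =
      fun x : ι → ℝ => ∑ j ∈ s, μ j * x j ^ 2 := by
    ext x
    rw [Finset.sum_apply]
  rw [e2] at hind
  have h := hind.symm.map_add_eq_map_conv_map₀ (hm i).aemeasurable
    (Finset.measurable_sum s fun j _ => hm j).aemeasurable
  rw [map_piNormal_mul_sq] at h
  rw [e1, h]

lemma exists_formLaw_eq_map_piNormal [DecidableEq ι] (μ : ι → ℝ) (s : Finset ι) :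
    ∃ l : List ℝ, l.sum = ∑ i ∈ s, μ i ∧ (∀ c ∈ l, ∃ i ∈ s, c = μ i) ∧
      (piNormal ι).map (fun x => ∑ i ∈ s, μ i * x i ^ 2) = formLaw l := by
  induction s using Finset.induction_on with
  | empty => exact ⟨[], by simp, by simp, by simp [formLaw]⟩
  | insert i s hi ih =>
    obtain ⟨l, h1, h2, h3⟩ := ih
    refine ⟨μ i :: l, ?_, ?_, ?_⟩
    · rw [List.sum_cons, Finset.sum_insert hi, h1]
    · intro c hc
      rcases List.mem_cons.1 hc with rfl | hc
      · exact ⟨i, by simp, rfl⟩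
      · obtain ⟨j, hj, rfl⟩ := h2 c hc
        exact ⟨j, by simp [hj], rfl⟩
    · rw [map_piNormal_sum_insert μ hi, h3, formLaw]

/-- `formLaw_Iic_le_sqLaw` wants the largest coefficient at the head of the list, so a maximal index
is split off first. -/
lemma map_piNormal_sum_Iic_le [DecidableEq ι] {μ : ι → ℝ} {s : Finset ι}
    (hμ : ∀ i ∈ s, 0 ≤ μ i) (hpos : 0 < ∑ i ∈ s, μ i) {t : ℝ} (ht : t ≤ ∑ i ∈ s, μ i) :
    (piNormal ι).map (fun x => ∑ i ∈ s, μ i * x i ^ 2) (Iic t) ≤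
      sqLaw (∑ i ∈ s, μ i) (Iic t) := by
  have hne : s.Nonempty := by
    by_contra h
    rw [Finset.not_nonempty_iff_eq_empty.1 h] at hpos
    simp at hpos
  obtain ⟨i, hi, hmax⟩ := s.exists_max_image μ hne
  have hi0 : 0 < μ i := by
    by_contra! h
    exact absurd (Finset.sum_nonpos fun j hj => (hmax j hj).trans h) (not_le.2 hpos)
  obtain ⟨l, h1, h2, h3⟩ := exists_formLaw_eq_map_piNormal μ (s.erase i)
  have h4 : (piNormal ι).map (fun x => ∑ i ∈ s, μ i * x i ^ 2) = formLaw (μ i :: l) := by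
    rw [formLaw, ← h3, ← map_piNormal_sum_insert μ (Finset.notMem_erase i s), Finset.insert_erase hi]
  have h5 : ∑ i ∈ s, μ i = μ i + l.sum := by rw [h1, Finset.add_sum_erase s μ hi]
  rw [h4, h5]
  refine formLaw_Iic_le_sqLaw hi0 (fun c hc => ?_) (h5 ▸ ht)
  obtain ⟨j, hj, rfl⟩ := h2 c hc
  exact ⟨hμ j (Finset.mem_of_mem_erase hj), hmax j (Finset.mem_of_mem_erase hj)⟩

lemma integrable_piNormal_mul_sq (c : ℝ) (i : ι) :
    Integrable (fun x : ι → ℝ => c * x i ^ 2) (piNormal ι) :=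
  ((measurePreserving_eval (fun _ : ι => stdNormal) i).integrable_comp_of_integrable
    integrable_stdNormal_sq).const_mul c

lemma integral_piNormal_sum_mul_sq (μ : ι → ℝ) (s : Finset ι) :
    ∫ x, ∑ i ∈ s, μ i * x i ^ 2 ∂piNormal ι = ∑ i ∈ s, μ i := by
  rw [integral_finsetSum _ fun i _ => integrable_piNormal_mul_sq (μ i) i]
  refine Finset.sum_congr rfl fun i _ => ?_
  rw [integral_const_mul]
  have h := (measurePreserving_eval (fun _ : ι => stdNormal) i).map_eq
  have h2 : ∫ x : ι → ℝ, x i ^ 2 ∂piNormal ι = ∫ z, z ^ 2 ∂stdNormal := by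
    rw [← h, integral_map (measurable_pi_apply i).aemeasurable (by fun_prop)]
  rw [h2, integral_stdNormal_sq, mul_one]

section Ratio

variable [DecidableEq ι] {μ : ι → ℝ} {i₀ : ι}

/-- Dropping the terms i ≠ i₀ on the left gives (1−t) x_{i₀}² ≤ t Σ_{i≠i₀} μ_i x_i². The two sides
are independent, so conditioning on the right and Jensen's inequality finish. -/
lemma piNormal_ratio_le (hμ0 : ∀ i, 0 ≤ μ i) (hi₀ : μ i₀ = 1) {t : ℝ} (ht0 : 0 ≤ t)
    (ht1 : t < 1) :
    piNormal ι {x | ∑ i, μ i ^ 2 * x i ^ 2 ≤ t * ∑ i, μ i * x i ^ 2} ≤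
      ENNReal.ofReal (chiSqCdf ((∑ i, μ i - 1) * t / (1 - t))) := by
  set s := Finset.univ.erase i₀ with hs
  have hmem : i₀ ∈ Finset.univ := Finset.mem_univ i₀
  set W : (ι → ℝ) → ℝ := fun x => t / (1 - t) * ∑ i ∈ s, μ i * x i ^ 2 with hW
  have h1t : 0 < 1 - t := by linarith
  have hc : 0 ≤ t / (1 - t) := div_nonneg ht0 h1t.le
  have hWm : Measurable W := by fun_prop
  have hW0 : ∀ x, 0 ≤ W x := fun x => mul_nonneg hc
    (Finset.sum_nonneg fun i _ => mul_nonneg (hμ0 i) (sq_nonneg _))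
  have hWint : Integrable W (piNormal ι) :=
    (integrable_finsetSum _ fun i _ => integrable_piNormal_mul_sq (μ i) i).const_mul _
  have hsub : {x : ι → ℝ | ∑ i, μ i ^ 2 * x i ^ 2 ≤ t * ∑ i, μ i * x i ^ 2} ⊆
      {x | x i₀ ^ 2 ≤ W x} := by
    intro x hx
    simp only [mem_ofPred_eq, hW] at hx ⊢
    rw [← Finset.add_sum_erase _ _ hmem, ← Finset.add_sum_erase _ (fun i => μ i * x i ^ 2) hmem,
      hi₀, ← hs] at hx
    have h2 : 0 ≤ ∑ i ∈ s, μ i ^ 2 * x i ^ 2 := Finset.sum_nonneg fun i _ => by positivity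
    rw [div_mul_eq_mul_div, le_div_iff₀ h1t]
    linarith
  refine (measure_mono hsub).trans ?_
  have hind : IndepFun (fun x : ι → ℝ => x i₀) W (piNormal ι) := by
    have h : iIndepFun (fun i (x : ι → ℝ) => x i) (piNormal ι) :=
      iIndepFun_pi (X := fun _ (z : ℝ) => z) fun i => by fun_prop
    have h2 := h.indepFun_finset {i₀} s (by simp [hs]) fun i => by fun_prop
    have hφ : Measurable fun y : ({i₀} : Finset ι) → ℝ => y ⟨i₀, by simp⟩ := measurable_pi_apply _
    have hψ : Measurable fun y : s → ℝ => t / (1 - t) * ∑ i : s, μ i * y i ^ 2 := by fun_prop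
    have h3 := h2.comp hφ hψ
    have hWeq : W = (fun y : s → ℝ => t / (1 - t) * ∑ i : s, μ i * y i ^ 2) ∘
        fun x (i : s) => x i := by
      funext x
      simp only [hW, Function.comp_apply]
      rw [Finset.sum_coe_sort s fun i => μ i * x i ^ 2]
    rw [hWeq]
    exact h3
  have hlaw := (indepFun_iff_map_prod_eq_prod_map_map (measurable_pi_apply i₀).aemeasurable
    hWm.aemeasurable).1 hind
  have heval : (piNormal ι).map (fun x => x i₀) = stdNormal :=
    (measurePreserving_eval (fun _ : ι => stdNormal) i₀).map_eq
  have hset : MeasurableSet {p : ℝ × ℝ | p.1 ^ 2 ≤ p.2} :=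
    measurableSet_le (by fun_prop) (by fun_prop)
  have hmeas : piNormal ι {x | x i₀ ^ 2 ≤ W x} =
      ∫⁻ x, ENNReal.ofReal (chiSqCdf (W x)) ∂piNormal ι := by
    have h1 : piNormal ι {x | x i₀ ^ 2 ≤ W x} =
        (piNormal ι).map (fun x => (x i₀, W x)) {p | p.1 ^ 2 ≤ p.2} := by
      rw [Measure.map_apply (by fun_prop) hset]
      rfl
    rw [h1, hlaw, heval, Measure.prod_apply_symm hset, lintegral_map
      (measurable_measure_prodMk_right hset) hWm]
    simp_rw [ofReal_chiSqCdf]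
    rfl
  rw [hmeas]
  refine (lintegral_chiSqCdf_le hW0 hWint).trans (le_of_eq ?_)
  have hmean : ∫ x, W x ∂piNormal ι = (∑ i, μ i - 1) * t / (1 - t) := by
    rw [hW, integral_const_mul, integral_piNormal_sum_mul_sq, ← Finset.add_sum_erase _ μ hmem, hi₀]
    ring
  rw [hmean]

/-- Fubini, with the ratio bound at t = τ − S for fixed y. The condition S ≤ τ makes the section
empty when t < 0. -/
lemma piNormal_prod_le (hμ0 : ∀ i, 0 ≤ μ i) (hi₀ : μ i₀ = 1) {τ : ℝ} (hτ1 : τ ≤ 1) :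
    (piNormal ι).prod (piNormal ι) {p | ∑ i, μ i ^ 2 * p.1 i ^ 2 ≤
        (τ - ∑ i, μ i * p.2 i ^ 2) * ∑ i, μ i * p.1 i ^ 2 ∧ ∑ i, μ i * p.2 i ^ 2 ≤ τ} ≤
      (((piNormal ι).map fun x => ∑ i, μ i * x i ^ 2).conv (ratioLaw (∑ i, μ i - 1))) (Iic τ) := by
  have hβ : 0 ≤ ∑ i, μ i - 1 := by
    rw [← hi₀, sub_nonneg]
    exact Finset.single_le_sum (fun i _ => hμ0 i) (Finset.mem_univ i₀)
  have hset : MeasurableSet {p : (ι → ℝ) × (ι → ℝ) | ∑ i, μ i ^ 2 * p.1 i ^ 2 ≤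
      (τ - ∑ i, μ i * p.2 i ^ 2) * ∑ i, μ i * p.1 i ^ 2 ∧ ∑ i, μ i * p.2 i ^ 2 ≤ τ} := by
    have h1 : Measurable fun p : (ι → ℝ) × (ι → ℝ) => ∑ i, μ i ^ 2 * p.1 i ^ 2 := by fun_prop
    have h2 : Measurable fun p : (ι → ℝ) × (ι → ℝ) => ∑ i, μ i * p.1 i ^ 2 := by fun_prop
    have h3 : Measurable fun p : (ι → ℝ) × (ι → ℝ) => ∑ i, μ i * p.2 i ^ 2 := by fun_prop
    exact (measurableSet_le h1 ((h3.const_sub τ).mul h2)).inter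
      (measurableSet_le h3 measurable_const)
  rw [Measure.prod_apply_symm hset, conv_Iic, lintegral_map ?_ (by fun_prop)]
  swap
  · have hm : Measurable fun p : ℝ × ℝ => (Iic τ).indicator (1 : ℝ → ENNReal) (p.1 + p.2) :=
      (measurable_one.indicator measurableSet_Iic).comp (by fun_prop)
    have : (fun a => ratioLaw (∑ i, μ i - 1) (Iic (τ - a))) =
        fun a => ∫⁻ v, (Iic τ).indicator (1 : ℝ → ENNReal) (a + v) ∂ratioLaw (∑ i, μ i - 1) := by
      ext a
      rw [← lintegral_indicator_one measurableSet_Iic]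
      congr 1; ext v
      by_cases h : v ≤ τ - a
      · rw [indicator_of_mem (s := Iic (τ - a)) h,
          indicator_of_mem (s := Iic τ) (show a + v ≤ τ by linarith)]; rfl
      · rw [indicator_of_notMem (s := Iic (τ - a)) h, indicator_of_notMem (s := Iic τ)
          (show ¬ a + v ≤ τ by intro h'; exact h (by linarith))]
    rw [this]
    exact hm.lintegral_prod_right'
  refine lintegral_mono_ae ?_
  -- This makes S > 0 almost surely, so t = τ − S < 1 even for τ = 1.
  have hpos : ∀ᵐ y ∂piNormal ι, y i₀ ≠ 0 := by
    have h : ∀ᵐ z ∂stdNormal, z ≠ 0 := by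
      have := nullSingletonClass_gaussianReal (μ := 0) one_ne_zero
      rw [ae_iff]; simp
    exact (measurePreserving_eval (fun _ : ι => stdNormal) i₀).quasiMeasurePreserving.ae h
  filter_upwards [hpos] with y hy
  set S := ∑ i, μ i * y i ^ 2 with hS
  have hS0 : 0 < S := by
    have h1 : 0 < μ i₀ * y i₀ ^ 2 := by rw [hi₀]; positivity
    exact h1.trans_le (Finset.single_le_sum (f := fun i => μ i * y i ^ 2)
      (fun i _ => mul_nonneg (hμ0 i) (sq_nonneg _)) (Finset.mem_univ i₀))
  by_cases hSτ : S ≤ τ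
  · rw [ratioLaw_Iic hβ (by linarith) (by linarith)]
    exact (measure_mono fun x hx => hx.1).trans
      (piNormal_ratio_le hμ0 hi₀ (by linarith) (by linarith))
  · refine le_of_eq_of_le ?_ zero_le
    convert measure_empty (μ := piNormal ι)
    ext x
    simp only [mem_empty_iff_false, iff_false]
    exact fun h => hSτ h.2

end Ratio

end Counterbalance

/-! ### The Chernoff bound for large effective rank. -/

namespace Counterbalance

open Set

variable {ι : Type*} [Fintype ι]

lemma integral_exp_neg_mul_sq {c : ℝ} (hc : 0 ≤ c) :
    ∫ z, Real.exp (-c * z ^ 2) ∂stdNormal = (√(1 + 2 * c))⁻¹ := by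
  rw [stdNormal, integral_gaussianReal_eq_integral_smul one_ne_zero]
  have h1 : ∀ z : ℝ, gaussianPDFReal 0 1 z • Real.exp (-c * z ^ 2) =
      (√(2 * Real.pi))⁻¹ * Real.exp (-(1 / 2 + c) * z ^ 2) := by
    intro z
    simp only [gaussianPDFReal, NNReal.coe_one, mul_one, sub_zero, smul_eq_mul]
    rw [mul_assoc, ← Real.exp_add]
    congr 2; ring
  simp_rw [h1]
  rw [integral_const_mul, integral_gaussian, ← Real.sqrt_inv, ← Real.sqrt_inv,
    ← Real.sqrt_mul (by positivity)]
  congr 1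
  have := Real.pi_pos
  field_simp

lemma mgf_piNormal_sum {μ : ι → ℝ} (hμ0 : ∀ i, 0 ≤ μ i) {c : ℝ} (hc0 : 0 ≤ c) :
    mgf (fun x : ι → ℝ => ∑ i, μ i * x i ^ 2) (piNormal ι) (-c) =
      ∏ i, (√(1 + 2 * (c * μ i)))⁻¹ := by
  have e1 : (fun x : ι → ℝ => ∑ i, μ i * x i ^ 2) =
      ∑ i, fun x : ι → ℝ => μ i * x i ^ 2 := by
    ext x; rw [Finset.sum_apply]
  rw [e1, (iIndepFun_mul_sq μ).mgf_sum (fun i => by fun_prop)]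
  refine Finset.prod_congr rfl fun i _ => ?_
  have h : ∫ z, Real.exp (-(c * μ i) * z ^ 2) ∂((piNormal ι).map fun x => x i) =
      ∫ x, Real.exp (-(c * μ i) * x i ^ 2) ∂piNormal ι :=
    integral_map (measurable_pi_apply i).aemeasurable (by fun_prop)
  have heval : (piNormal ι).map (fun x => x i) = stdNormal :=
    (measurePreserving_eval (fun _ : ι => stdNormal) i).map_eq
  rw [← integral_exp_neg_mul_sq (mul_nonneg hc0 (hμ0 i)), ← heval, h, mgf]
  refine integral_congr_ae (ae_of_all _ fun x => ?_)
  simp only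
  congr 1; ring

lemma piNormal_sum_le_exp_mul {μ : ι → ℝ} (hμ0 : ∀ i, 0 ≤ μ i) {c : ℝ} (hc0 : 0 ≤ c) (τ : ℝ) :
    (piNormal ι).real {x | ∑ i, μ i * x i ^ 2 ≤ τ} ≤
      Real.exp (c * τ) * ∏ i, (√(1 + 2 * (c * μ i)))⁻¹ := by
  rw [← mgf_piNormal_sum hμ0 hc0]
  set X : (ι → ℝ) → ℝ := fun x => ∑ i, μ i * x i ^ 2 with hX
  have hXm : Measurable X := by fun_prop
  have hX0 : ∀ x, 0 ≤ X x := fun x =>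
    Finset.sum_nonneg fun i _ => mul_nonneg (hμ0 i) (sq_nonneg _)
  have hint : Integrable (fun x => Real.exp (-c * X x)) (piNormal ι) := by
    clear_value X
    have hm : Measurable fun x => Real.exp (-c * X x) := by fun_prop
    refine Integrable.of_bound hm.aestronglyMeasurable 1 (ae_of_all _ fun x => ?_)
    rw [Real.norm_of_nonneg (Real.exp_pos _).le, Real.exp_le_one_iff]
    have := mul_nonneg hc0 (hX0 x)
    linarith
  have h1 := measure_le_le_exp_mul_mgf τ (neg_nonpos.2 hc0) hint
  rw [neg_neg] at h1
  exact h1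

/-- Bernoulli: K^m ≤ 1 + (K−1)m for m in [0, 1]. The product over the coefficients is then
controlled by their sum alone. -/
lemma inv_sqrt_one_add_le_rpow {K m : ℝ} (hK : 1 ≤ K) (hm0 : 0 ≤ m) (hm1 : m ≤ 1) :
    (√(1 + 2 * ((K - 1) / 2 * m)))⁻¹ ≤ K ^ (-(m / 2)) := by
  have hb := rpow_one_add_le_one_add_mul_self (s := K - 1) (by linarith) hm0 hm1
  rw [Real.rpow_neg (by linarith)]
  refine inv_anti₀ (by positivity) ?_
  rw [show m / 2 = m * (1 / 2) by ring, Real.rpow_mul (by linarith), ← Real.sqrt_eq_rpow]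
  refine Real.sqrt_le_sqrt ?_
  rw [add_sub_cancel] at hb
  linarith

lemma four_div_rpow_le {τ : ℝ} (hτ0 : 0 < τ) (hτ1 : τ ≤ 1) :
    (4 / τ) ^ (-(7 / 2) : ℝ) ≤ τ ^ 2 / 128 := by
  have hK4 : 4 ≤ 4 / τ := by rw [le_div_iff₀ hτ0]; linarith
  have hK0 : 0 < 4 / τ := by positivity
  -- The exponent 2 supplies τ²/16, and the rest is at most 4^(-3/2) = 1/8.
  have e1 : (4 / τ) ^ (-(7 / 2) : ℝ) = (4 / τ) ^ (-2 : ℝ) * (4 / τ) ^ (-(3 / 2) : ℝ) := by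
    rw [← Real.rpow_add hK0]; norm_num
  have e2 : (4 / τ) ^ (-2 : ℝ) = τ ^ 2 / 16 := by
    rw [Real.rpow_neg hK0.le, Real.rpow_two, div_pow, inv_div]
    norm_num
  have e3 : (4 / τ) ^ (-(3 / 2) : ℝ) ≤ 1 / 8 := by
    calc (4 / τ) ^ (-(3 / 2) : ℝ) ≤ (4 : ℝ) ^ (-(3 / 2) : ℝ) :=
          Real.rpow_le_rpow_of_nonpos (by norm_num) hK4 (by norm_num)
      _ = 1 / 8 := by
          rw [show (4 : ℝ) = 2 ^ (2 : ℝ) by norm_num, ← Real.rpow_mul (by norm_num),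
            show (2 : ℝ) * -(3 / 2) = -(3 : ℕ) by norm_num, Real.rpow_neg (by norm_num),
            Real.rpow_natCast]
          norm_num
  rw [e1, e2]
  calc τ ^ 2 / 16 * (4 / τ) ^ (-(3 / 2) : ℝ) ≤ τ ^ 2 / 16 * (1 / 8) := by gcongr
    _ = τ ^ 2 / 128 := by ring

/-- A Chernoff bound for the lower tail of a positive Gaussian quadratic form. -/
lemma piNormal_sum_le_of_seven_le {μ : ι → ℝ} (hμ0 : ∀ i, 0 ≤ μ i) (hμ1 : ∀ i, μ i ≤ 1)
    (hρ : 7 ≤ ∑ i, μ i) {τ : ℝ} (hτ0 : 0 < τ) (hτ1 : τ ≤ 1) :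
    (piNormal ι).real {x | ∑ i, μ i * x i ^ 2 ≤ τ} ≤ τ ^ 2 / 8 := by
  have hK4 : 4 ≤ 4 / τ := by rw [le_div_iff₀ hτ0]; linarith
  -- The Chernoff parameter is c = (K−1)/2 with K = 4/τ, so that 1 + 2cμ_i = 1 + (K−1)μ_i ≥ K^(μ_i).
  have hprod : ∏ i, (√(1 + 2 * ((4 / τ - 1) / 2 * μ i)))⁻¹ ≤ (4 / τ) ^ (-(7 / 2) : ℝ) := by
    calc _ ≤ ∏ i, (4 / τ) ^ (-(μ i / 2)) :=
          Finset.prod_le_prod (fun i _ => inv_nonneg.2 (Real.sqrt_nonneg _)) fun i _ =>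
            inv_sqrt_one_add_le_rpow (by linarith) (hμ0 i) (hμ1 i)
      _ = (4 / τ) ^ (∑ i, -(μ i / 2)) := (Real.rpow_sum_of_pos (by linarith) _ _).symm
      _ ≤ (4 / τ) ^ (-(7 / 2) : ℝ) := by
          refine Real.rpow_le_rpow_of_exponent_le (by linarith) ?_
          rw [Finset.sum_neg_distrib, ← Finset.sum_div]
          linarith
  -- The exponent is (4 − τ)/2 ≤ 2; any bound up to 16 = 128/8 suffices.
  have hexp : Real.exp ((4 / τ - 1) / 2 * τ) ≤ 16 := by
    have e1 : (4 / τ - 1) / 2 * τ ≤ 1 + 1 := by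
      have : (4 / τ - 1) / 2 * τ = (4 - τ) / 2 := by field_simp
      rw [this]; linarith
    have e2 : Real.exp 1 ≤ 3 := by linarith [Real.exp_one_lt_d9]
    calc Real.exp ((4 / τ - 1) / 2 * τ) ≤ Real.exp (1 + 1) := Real.exp_le_exp.2 e1
      _ = Real.exp 1 * Real.exp 1 := Real.exp_add 1 1
      _ ≤ 3 * 3 := mul_le_mul e2 e2 (Real.exp_pos _).le (by norm_num)
      _ ≤ 16 := by norm_num
  refine (piNormal_sum_le_exp_mul hμ0 (by linarith : 0 ≤ (4 / τ - 1) / 2) τ).trans ?_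
  calc _ ≤ 16 * (τ ^ 2 / 128) :=
        mul_le_mul hexp (hprod.trans (four_div_rpow_le hτ0 hτ1))
          (Finset.prod_nonneg fun i _ => inv_nonneg.2 (Real.sqrt_nonneg _)) (by norm_num)
    _ = τ ^ 2 / 8 := by ring

end Counterbalance

/-! ### Singular values and the reduction of the event. -/

namespace Counterbalance

open Set

section Spectral

variable {m n : ℕ} (A : Matrix (Fin m) (Fin n) ℝ)

lemma norm_toEuclideanLin_sq (x : EuclideanSpace ℝ (Fin n)) :
    ‖Matrix.toEuclideanLin A x‖ ^ 2 =
      inner ℝ x (Matrix.toEuclideanLin (A.transpose * A) x) := by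
  have h : Matrix.toEuclideanLin (A.transpose * A) x =
      LinearMap.adjoint (Matrix.toEuclideanLin A) (Matrix.toEuclideanLin A x) := by
    rw [← Matrix.toEuclideanLin_conjTranspose_eq_adjoint, Matrix.conjTranspose_eq_transpose_of_trivial]
    simp [Matrix.toLpLin_apply, Matrix.mulVec_mulVec]
  rw [h, LinearMap.adjoint_inner_right, real_inner_self_eq_norm_sq]

lemma norm_toEuclideanLin_le (x : EuclideanSpace ℝ (Fin n)) :
    ‖Matrix.toEuclideanLin A x‖ ≤ opNorm A * ‖x‖ :=
  (LinearMap.toContinuousLinearMap (Matrix.toEuclideanLin A)).le_opNorm x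

lemma opNorm_pos {A : Matrix (Fin m) (Fin n) ℝ} (hA : A ≠ 0) : 0 < opNorm A := by
  rw [opNorm, norm_pos_iff]
  simpa using hA

/-- The singular value decomposition, in terms of an orthonormal basis of right singular vectors
and of the squares of the singular values. -/
lemma exists_singular_basis {A : Matrix (Fin m) (Fin n) ℝ} (hA : A ≠ 0) :
    ∃ (b : OrthonormalBasis (Fin n) ℝ (EuclideanSpace ℝ (Fin n))) (l : Fin n → ℝ) (i₀ : Fin n),
      (∀ i, 0 ≤ l i) ∧ (∀ i, l i ≤ opNorm A ^ 2) ∧ l i₀ = opNorm A ^ 2 ∧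
      ∑ i, l i = frobNorm A ^ 2 ∧
      (∀ x, ‖Matrix.toEuclideanLin A x‖ ^ 2 = ∑ i, l i * inner ℝ (b i) x ^ 2) ∧
      (∀ x, ‖Matrix.toEuclideanLin (A.transpose * A) x‖ ^ 2 =
        ∑ i, l i ^ 2 * inner ℝ (b i) x ^ 2) := by
  have hpsd : (A.transpose * A).PosSemidef := by
    have := Matrix.posSemidef_conjTranspose_mul_self A
    rwa [Matrix.conjTranspose_eq_transpose_of_trivial] at this
  have hM := hpsd.1
  set b := hM.eigenvectorBasis with hb
  set l := hM.eigenvalues with hl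
  have hl0 : ∀ i, 0 ≤ l i := hpsd.eigenvalues_nonneg
  have heig : ∀ i, Matrix.toEuclideanLin (A.transpose * A) (b i) = l i • b i := by
    intro i
    have := hM.mulVec_eigenvectorBasis i
    ext j
    simpa [Matrix.toLpLin_apply] using congrFun this j
  have hinner : ∀ i x, inner ℝ (b i) (Matrix.toEuclideanLin (A.transpose * A) x) =
      l i * inner ℝ (b i) x := by
    intro i x
    rw [← (Matrix.isSymmetric_toEuclideanLin_iff.2 hM) (b i) x, heig, real_inner_smul_left]
  have h1 : ∀ x, ‖Matrix.toEuclideanLin A x‖ ^ 2 = ∑ i, l i * inner ℝ (b i) x ^ 2 := by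
    intro x
    rw [norm_toEuclideanLin_sq, ← b.sum_inner_mul_inner]
    refine Finset.sum_congr rfl fun i _ => ?_
    rw [hinner, real_inner_comm]
    ring
  have h2 : ∀ x, ‖Matrix.toEuclideanLin (A.transpose * A) x‖ ^ 2 =
      ∑ i, l i ^ 2 * inner ℝ (b i) x ^ 2 := by
    intro x
    rw [← b.sum_sq_norm_inner_right]
    refine Finset.sum_congr rfl fun i _ => ?_
    rw [hinner, Real.norm_eq_abs, sq_abs, mul_pow]
  have hle : ∀ i, l i ≤ opNorm A ^ 2 := by
    intro i
    have h3 := norm_toEuclideanLin_le A (b i)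
    rw [b.norm_eq_one, mul_one] at h3
    have h4 : ‖Matrix.toEuclideanLin A (b i)‖ ^ 2 = l i := by
      rw [norm_toEuclideanLin_sq, hinner, real_inner_self_eq_norm_sq, b.norm_eq_one]
      ring
    rw [← h4]
    gcongr
  have hne : Nonempty (Fin n) := by
    by_contra h
    rw [not_nonempty_iff] at h
    exact hA (by ext i j; exact h.elim j)
  obtain ⟨i₀, -, hmax⟩ := Finset.univ.exists_max_image l Finset.univ_nonempty
  refine ⟨b, l, i₀, hl0, hle, le_antisymm (hle i₀) ?_, ?_, h1, h2⟩
  -- The largest eigenvalue of AᵀA attains ‖A‖²: expanding ‖Ax‖² in the eigenbasis bounds it by this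
  -- eigenvalue times ‖x‖².
  · have h3 : opNorm A ≤ √(l i₀) := by
      refine ContinuousLinearMap.opNorm_le_bound _ (Real.sqrt_nonneg _) fun x => ?_
      change ‖Matrix.toEuclideanLin A x‖ ≤ _
      rw [← abs_of_nonneg (norm_nonneg (Matrix.toEuclideanLin A x)), ← Real.sqrt_sq_eq_abs,
        ← Real.sqrt_sq (norm_nonneg x), ← Real.sqrt_mul (hl0 i₀)]
      refine Real.sqrt_le_sqrt ?_
      rw [h1, ← b.sum_sq_norm_inner_right, Finset.mul_sum]
      refine Finset.sum_le_sum fun i _ => ?_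
      rw [Real.norm_eq_abs, sq_abs]
      exact mul_le_mul_of_nonneg_right (hmax i (Finset.mem_univ i)) (sq_nonneg _)
    calc opNorm A ^ 2 ≤ √(l i₀) ^ 2 := by
          have := (opNorm_pos hA).le
          gcongr
      _ = l i₀ := Real.sq_sqrt (hl0 i₀)
  · have h3 := hM.trace_eq_sum_eigenvalues
    simp only [RCLike.ofReal_real_eq_id, id] at h3
    have h4 : 0 ≤ ∑ i, ∑ j, A i j ^ 2 :=
      Finset.sum_nonneg fun i _ => Finset.sum_nonneg fun j _ => sq_nonneg _
    rw [← h3, frobNorm, Real.sq_sqrt h4, Finset.sum_comm]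
    simp [Matrix.trace, Matrix.mul_apply, sq]

end Spectral

section Event

variable {ι : Type*} [Fintype ι] {μ : ι → ℝ} {i₀ : ι}

lemma map_piNormal_sum_univ_eq [DecidableEq ι] (hi₀ : μ i₀ = 1) :
    (piNormal ι).map (fun x => ∑ i, μ i * x i ^ 2) =
      (sqLaw 1).conv ((piNormal ι).map fun x => ∑ i ∈ Finset.univ.erase i₀, μ i * x i ^ 2) := by
  rw [← hi₀, ← map_piNormal_sum_insert μ (Finset.notMem_erase i₀ _),
    Finset.insert_erase (Finset.mem_univ i₀)]

lemma map_piNormal_sum_univ_Iic_le_weightedChiSq [DecidableEq ι] (hμ0 : ∀ i, 0 ≤ μ i)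
    (hi₀ : μ i₀ = 1)
    {t : ℝ} (hpos : 0 < ∑ i, μ i - 1) (ht : t ≤ ∑ i, μ i - 1) :
    (piNormal ι).map (fun x => ∑ i, μ i * x i ^ 2) (Iic t) ≤
      weightedChiSq (∑ i, μ i - 1) (Iic t) := by
  have hsum : ∑ i, μ i - 1 = ∑ i ∈ Finset.univ.erase i₀, μ i := by
    rw [← Finset.add_sum_erase _ μ (Finset.mem_univ i₀), hi₀]; ring
  have hm : Measurable fun x : ι → ℝ => ∑ i ∈ Finset.univ.erase i₀, μ i * x i ^ 2 := by fun_prop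
  have := Measure.isProbabilityMeasure_map (μ := piNormal ι) hm.aemeasurable
  rw [hsum] at hpos ht ⊢
  rw [map_piNormal_sum_univ_eq hi₀, weightedChiSq_eq_conv, Measure.conv_comm,
    Measure.conv_comm (sqLaw 1)]
  exact conv_Iic_mono (sqLaw_nonneg zero_le_one) fun s hs =>
    map_piNormal_sum_Iic_le (fun i _ => hμ0 i) hpos (hs.trans ht)

lemma map_piNormal_sum_univ_Iic_le_chiSq (hμ0 : ∀ i, 0 ≤ μ i) (hi₀ : μ i₀ = 1) (t : ℝ) :
    (piNormal ι).map (fun x => ∑ i, μ i * x i ^ 2) (Iic t) ≤ weightedChiSq 0 (Iic t) := by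
  rw [weightedChiSq_zero, ← map_piNormal_mul_sq 1 i₀,
    Measure.map_apply (by fun_prop) measurableSet_Iic,
    Measure.map_apply (by fun_prop) measurableSet_Iic]
  refine measure_mono fun x hx => ?_
  have h1 : μ i₀ * x i₀ ^ 2 ≤ ∑ i, μ i * x i ^ 2 :=
    Finset.single_le_sum (f := fun i => μ i * x i ^ 2)
      (fun i _ => mul_nonneg (hμ0 i) (sq_nonneg _)) (Finset.mem_univ i₀)
  rw [hi₀] at h1
  exact h1.trans hx

end Event

section Statistic

variable {m n : ℕ} (A : Matrix (Fin m) (Fin n) ℝ)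

lemma measurable_statistic (θ : ℝ) :
    Measurable fun p : EuclideanSpace ℝ (Fin n) × EuclideanSpace ℝ (Fin n) =>
      statistic A θ p.1 p.2 := by
  unfold statistic
  fun_prop

/-- The standard Gaussian has independent standard normal coordinates in every orthonormal basis, in
particular in that of the singular vectors. -/
lemma measure_statistic_eq {Ω : Type*} [MeasurableSpace Ω] {P : Measure Ω}
    [IsProbabilityMeasure P] {X₁ X₂ : Ω → EuclideanSpace ℝ (Fin n)}
    (hX₁ : HasLaw X₁ (stdGaussian (EuclideanSpace ℝ (Fin n))) P)
    (hX₂ : HasLaw X₂ (stdGaussian (EuclideanSpace ℝ (Fin n))) P)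
    (hind : IndepFun X₁ X₂ P) (b : OrthonormalBasis (Fin n) ℝ (EuclideanSpace ℝ (Fin n)))
    (θ c : ℝ) :
    P {ω | statistic A θ (X₁ ω) (X₂ ω) ≤ c} =
      (piNormal (Fin n)).prod (piNormal (Fin n))
        {p | statistic A θ (∑ i, p.1 i • b i) (∑ i, p.2 i • b i) ≤ c} := by
  have hset : MeasurableSet {p : EuclideanSpace ℝ (Fin n) × EuclideanSpace ℝ (Fin n) |
      statistic A θ p.1 p.2 ≤ c} := measurableSet_le (measurable_statistic A θ) measurable_const
  have hlaw := (indepFun_iff_map_prod_eq_prod_map_map hX₁.aemeasurable hX₂.aemeasurable).1 hind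
  have he : Measurable fun x : Fin n → ℝ => ∑ i, x i • b i := by fun_prop
  have h1 : P {ω | statistic A θ (X₁ ω) (X₂ ω) ≤ c} =
      P.map (fun ω => (X₁ ω, X₂ ω)) {p | statistic A θ p.1 p.2 ≤ c} := by
    rw [Measure.map_apply_of_aemeasurable (hX₁.aemeasurable.prodMk hX₂.aemeasurable) hset]
    rfl
  rw [h1, hlaw, hX₁.map_eq, hX₂.map_eq, stdGaussian_eq_map_pi_orthonormalBasis b,
    Measure.map_prod_map _ _ he he, Measure.map_apply (he.prodMap he) hset]
  rfl

variable {A}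

lemma ratio_le_of_statistic_le {l : Fin n → ℝ} {σ θ : ℝ}
    (b : OrthonormalBasis (Fin n) ℝ (EuclideanSpace ℝ (Fin n)))
    (hl0 : ∀ i, 0 ≤ l i) (hσ : 0 < σ) (hlσ : ∀ i, l i ≤ σ ^ 2) (hθ : 0 < θ)
    (h1 : ∀ x, ‖Matrix.toEuclideanLin A x‖ ^ 2 = ∑ i, l i * inner ℝ (b i) x ^ 2)
    (h2 : ∀ x, ‖Matrix.toEuclideanLin (A.transpose * A) x‖ ^ 2 =
        ∑ i, l i ^ 2 * inner ℝ (b i) x ^ 2) {x y : Fin n → ℝ}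
    (h : statistic A θ (∑ i, x i • b i) (∑ i, y i • b i) ≤ σ) :
    ∑ i, (l i / σ ^ 2) ^ 2 * x i ^ 2 ≤
        ((θ ^ 2)⁻¹ - ∑ i, l i / σ ^ 2 * y i ^ 2) * ∑ i, l i / σ ^ 2 * x i ^ 2 ∧
      ∑ i, l i / σ ^ 2 * y i ^ 2 ≤ (θ ^ 2)⁻¹ := by
  have hcoord : ∀ (z : Fin n → ℝ) i, inner ℝ (b i) (∑ j, z j • b j) = z i := by
    intro z i
    rw [b.orthonormal.inner_right_fintype]
  have hN : ∑ i, (l i / σ ^ 2) ^ 2 * x i ^ 2 = (∑ i, l i ^ 2 * x i ^ 2) / σ ^ 4 := by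
    rw [Finset.sum_div]
    exact Finset.sum_congr rfl fun i _ => by field_simp
  have hD : ∀ z : Fin n → ℝ, ∑ i, l i / σ ^ 2 * z i ^ 2 = (∑ i, l i * z i ^ 2) / σ ^ 2 := by
    intro z
    rw [Finset.sum_div]
    exact Finset.sum_congr rfl fun i _ => by field_simp
  rw [statistic, div_pow, h1, h2, h1] at h
  simp only [hcoord] at h
  rw [hN, hD, hD]
  have hD0 : 0 ≤ ∑ i, l i * x i ^ 2 :=
    Finset.sum_nonneg fun i _ => mul_nonneg (hl0 i) (sq_nonneg _)
  have hS0 : 0 ≤ ∑ i, l i * y i ^ 2 :=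
    Finset.sum_nonneg fun i _ => mul_nonneg (hl0 i) (sq_nonneg _)
  have hN0 : 0 ≤ ∑ i, l i ^ 2 * x i ^ 2 := Finset.sum_nonneg fun i _ => by positivity
  have hND : ∑ i, l i ^ 2 * x i ^ 2 ≤ σ ^ 2 * ∑ i, l i * x i ^ 2 := by
    rw [Finset.mul_sum]
    refine Finset.sum_le_sum fun i _ => ?_
    rw [sq (l i), mul_assoc]
    exact mul_le_mul_of_nonneg_right (hlσ i) (mul_nonneg (hl0 i) (sq_nonneg _))
  generalize ∑ i, l i ^ 2 * x i ^ 2 = N at *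
  generalize ∑ i, l i * x i ^ 2 = D at *
  generalize ∑ i, l i * y i ^ 2 = S at *
  have hr0 : 0 ≤ N / D := div_nonneg hN0 hD0
  -- If D = 0 the quotient is 0 by convention, but then N ≤ σ² D gives N ≤ 0 as well.
  have hNr : N ≤ N / D * D := by
    rcases hD0.eq_or_lt with hD | hD
    · rw [← hD] at hND ⊢
      linarith
    · rw [div_mul_cancel₀ _ hD.ne']
  have hsq : θ ^ 2 * (N / D + S) ≤ σ ^ 2 := by
    have h3 : (θ * √(N / D + S)) ^ 2 ≤ σ ^ 2 := by gcongr
    rwa [mul_pow, Real.sq_sqrt (by positivity)] at h3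
  have hsum : N / D + S ≤ σ ^ 2 * (θ ^ 2)⁻¹ := by
    rw [← div_eq_mul_inv, le_div_iff₀ (by positivity)]
    linarith
  have hσ2 : 0 < σ ^ 2 := by positivity
  constructor
  · have h3 : N ≤ (σ ^ 2 * (θ ^ 2)⁻¹ - S) * D :=
      hNr.trans (mul_le_mul_of_nonneg_right (by linarith) hD0)
    have h4 : ((θ ^ 2)⁻¹ - S / σ ^ 2) * (D / σ ^ 2) =
        (σ ^ 2 * (θ ^ 2)⁻¹ - S) * D / σ ^ 4 := by
      field_simp
    rw [h4]
    gcongr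
  · rw [div_le_iff₀ hσ2]
    linarith

end Statistic

end Counterbalance

/-! ### The three regimes of the effective rank. -/

open Counterbalance Set

theorem theorem1 {m n : ℕ} (A : Matrix (Fin m) (Fin n) ℝ) (hA : A ≠ 0) (ρ : ℝ)
    (hρ : ρ = Counterbalance.effectiveRank A)
    {Ω : Type*} [MeasurableSpace Ω] (P : Measure Ω) [IsProbabilityMeasure P]
    (X₁ X₂ : Ω → EuclideanSpace ℝ (Fin n))
    (hX₁ : HasLaw X₁ (stdGaussian (EuclideanSpace ℝ (Fin n))) P)
    (hX₂ : HasLaw X₂ (stdGaussian (EuclideanSpace ℝ (Fin n))) P)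
    (hind : IndepFun X₁ X₂ P) (θ : ℝ) (hθ : 1 ≤ θ) :
    (7 ≤ ρ →
      P.real {ω | Counterbalance.statistic A θ (X₁ ω) (X₂ ω) ≤ Counterbalance.opNorm A}
        ≤ (θ ^ 4)⁻¹ / 8) ∧
    (1 + (θ ^ 2)⁻¹ ≤ ρ → ρ ≤ 7 →
      P.real {ω | Counterbalance.statistic A θ (X₁ ω) (X₂ ω) ≤ Counterbalance.opNorm A}
        ≤ ∫ t in (0 : ℝ)..(θ ^ 2)⁻¹,
            Counterbalance.chiSqCdf ((ρ - 1) * t / (1 - t)) *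
              Counterbalance.weightedChiSqPdf (ρ - 1) ((θ ^ 2)⁻¹ - t)) ∧
    (ρ < 1 + (θ ^ 2)⁻¹ →
      P.real {ω | Counterbalance.statistic A θ (X₁ ω) (X₂ ω) ≤ Counterbalance.opNorm A}
        ≤ ∫ t in (0 : ℝ)..(θ ^ 2)⁻¹,
            Counterbalance.chiSqCdf ((ρ - 1) * t / (1 - t)) *
              Counterbalance.weightedChiSqPdf 0 (((θ ^ 2)⁻¹ - t) / ρ)) := by
  obtain ⟨b, l, i₀, hl0, hlσ, hi₀, hfrob, h1, h2⟩ := exists_singular_basis hA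
  have hσ := opNorm_pos hA
  set σ := opNorm A with hσdef
  set μ : Fin n → ℝ := fun i => l i / σ ^ 2 with hμ
  have hμ0 : ∀ i, 0 ≤ μ i := fun i => div_nonneg (hl0 i) (sq_nonneg _)
  have hμ1 : ∀ i, μ i ≤ 1 := fun i => div_le_one_of_le₀ (hlσ i) (sq_nonneg _)
  have hμi₀ : μ i₀ = 1 := by rw [hμ]; simp only; rw [hi₀, div_self (by positivity)]
  have hsum : ∑ i, μ i = ρ := by rw [hρ, effectiveRank, ← hfrob, Finset.sum_div]
  have hρ1 : 1 ≤ ρ := by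
    rw [← hsum, ← hμi₀]
    exact Finset.single_le_sum (fun i _ => hμ0 i) (Finset.mem_univ i₀)
  set τ := (θ ^ 2)⁻¹ with hτ
  have hτ0 : 0 < τ := by positivity
  have hτ1 : τ ≤ 1 := inv_le_one_of_one_le₀ (one_le_pow₀ hθ)
  have hsub : {p : (Fin n → ℝ) × (Fin n → ℝ) |
      statistic A θ (∑ i, p.1 i • b i) (∑ i, p.2 i • b i) ≤ σ} ⊆
      {p | ∑ i, μ i ^ 2 * p.1 i ^ 2 ≤ (τ - ∑ i, μ i * p.2 i ^ 2) * ∑ i, μ i * p.1 i ^ 2 ∧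
        ∑ i, μ i * p.2 i ^ 2 ≤ τ} := fun p hp =>
    ratio_le_of_statistic_le b hl0 hσ hlσ (by linarith) h1 h2 hp
  have hP : P {ω | statistic A θ (X₁ ω) (X₂ ω) ≤ σ} ≤ (piNormal (Fin n)).prod (piNormal (Fin n))
      {p | ∑ i, μ i ^ 2 * p.1 i ^ 2 ≤ (τ - ∑ i, μ i * p.2 i ^ 2) * ∑ i, μ i * p.1 i ^ 2 ∧
        ∑ i, μ i * p.2 i ^ 2 ≤ τ} := by
    rw [measure_statistic_eq A hX₁ hX₂ hind b θ σ]
    exact measure_mono hsub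
  have hm : Measurable fun x : Fin n → ℝ => ∑ i, μ i * x i ^ 2 := by fun_prop
  have hconv : P {ω | statistic A θ (X₁ ω) (X₂ ω) ≤ σ} ≤
      (((piNormal (Fin n)).map fun x => ∑ i, μ i * x i ^ 2).conv (ratioLaw (ρ - 1))) (Iic τ) := by
    have := piNormal_prod_le hμ0 hμi₀ hτ1
    rw [hsum] at this
    exact hP.trans this
  have hβ : 0 ≤ ρ - 1 := by linarith
  refine ⟨fun h7 => ?_, fun hρτ _ => ?_, fun _ => ?_⟩
  · have h3 : P {ω | statistic A θ (X₁ ω) (X₂ ω) ≤ σ} ≤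
        piNormal (Fin n) {x | ∑ i, μ i * x i ^ 2 ≤ τ} := by
      refine hP.trans ((measure_mono (t := univ ×ˢ {x | ∑ i, μ i * x i ^ 2 ≤ τ})
        fun p hp => ⟨mem_univ _, hp.2⟩).trans ?_)
      rw [Measure.prod_prod, measure_univ, one_mul]
    have h4 := piNormal_sum_le_of_seven_le hμ0 hμ1 (hsum ▸ h7) hτ0 hτ1
    have h5 : (θ ^ 4)⁻¹ / 8 = τ ^ 2 / 8 := by rw [hτ, inv_pow, ← pow_mul]
    rw [h5]
    exact (ENNReal.toReal_mono (measure_ne_top _ _) h3).trans h4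
  · refine ENNReal.toReal_le_of_le_ofReal (intervalIntegral.integral_nonneg hτ0.le fun t _ =>
      mul_nonneg (chiSqCdf_nonneg _) ENNReal.toReal_nonneg) ?_
    rw [← conv_weightedChiSq_Iic hβ hβ hτ0 hτ1]
    refine hconv.trans (conv_Iic_mono (ratioLaw_Iio_zero hβ) fun s hs => ?_)
    -- The regime ρ ≥ 1 + τ enters here: s ≤ τ ≤ ρ − 1 lies below the mean of the form without its
    -- top term.
    have := map_piNormal_sum_univ_Iic_le_weightedChiSq (t := s) hμ0 hμi₀
      (by rw [hsum]; linarith) (by rw [hsum]; linarith)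
    rwa [hsum] at this
  -- The bound first obtained has the density at τ − t; dividing its argument by ρ ≥ 1 only enlarges
  -- the integral.
  · have h3 : P {ω | statistic A θ (X₁ ω) (X₂ ω) ≤ σ} ≤ ENNReal.ofReal
        (∫ t in (0 : ℝ)..τ, chiSqCdf ((ρ - 1) * t / (1 - t)) * weightedChiSqPdf 0 (τ - t)) := by
      rw [← conv_weightedChiSq_Iic le_rfl hβ hτ0 hτ1]
      exact hconv.trans (conv_Iic_mono (ratioLaw_Iio_zero hβ) fun s _ =>
        map_piNormal_sum_univ_Iic_le_chiSq hμ0 hμi₀ s)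
    have h4 : 0 ≤ ∫ t in (0 : ℝ)..τ,
        chiSqCdf ((ρ - 1) * t / (1 - t)) * weightedChiSqPdf 0 (τ - t) :=
      intervalIntegral.integral_nonneg hτ0.le fun t _ =>
        mul_nonneg (chiSqCdf_nonneg _) ENNReal.toReal_nonneg
    exact (ENNReal.toReal_le_of_le_ofReal h4 h3).trans (integral_chiSqCdf_mul_pdf_le hτ0 hρ1)
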